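/- Consider an equation $$y''=P(x,y)+3Q(x,y)y'+3R(x,y)y'^2+S(x,y)y'^3 \qquad (1)$$ with smooth real (or holomorphic complex) coefficients on a nonempty open domain $D$ of the $(x,y)$-plane. Write $K_{i.j}=\partial^{i+j}K/\partial x^i\partial y^j$ and put $$A=P_{0.2}-2Q_{1.1}+R_{2.0}+2PS_{1.0}+SP_{1.0}-3PR_{0.1}-3RP_{0.1}-3QR_{1.0}+6QQ_{0.1},$$ $$B=S_{2.0}-2R_{1.1}+Q_{0.2}-2SP_{0.1}-PS_{0.1}+3SQ_{1.0}+3QS_{1.0}+3RQ_{0.1}-6RR_{1.0},$$ $$G=-BB_{1.0}-3AB_{0.1}+4BA_{0.1}+3SA^2-6RBA+3QB^2,\qquad H=-AA_{0.1}-3BA_{1.0}+4AB_{1.0}-3PB^2+6QAB-3RA^2,\qquad 3F^5=AG+BH.$$ Where $A\ne0$ let $N=-\frac{H}{3A}$ and $$\varphi_1=-\frac{3(BP+A_{1.0})}{5A}+\frac35Q,\qquad \varphi_2=\frac{3B(BP+A_{1.0})}{5A^2}-\frac{3(B_{1.0}+A_{0.1}+3BQ)}{5A}+\frac65R;$$ where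 $B\ne0$ let $N=\frac{G}{3B}$ and $$\varphi_1=-\frac{3A(AS-B_{0.1})}{5B^2}-\frac{3(A_{0.1}+B_{1.0}-3AR)}{5B}-\frac65Q,\qquad \varphi_2=\frac{3(AS-B_{0.1})}{5B}-\frac35R.$$ In either case, for a function $f$ of weight $m$ put $\nabla_1f=f_{1.0}+m\varphi_1f$ and $\nabla_2f=f_{0.1}+m\varphi_2f$, and define (with $N$ of weight $2$ and $M$ of weight $4$) $$\Omega=\tfrac53\big((\varphi_1)_{0.1}-(\varphi_2)_{1.0}\big),\quad M=B\,\nabla_1N-A\,\nabla_2N,\quad Z=\nabla_1M\,\nabla_2N-\nabla_2M\,\nabla_1N,$$ $$I_1=\frac{M}{N^2},\quad I_4=\frac{B(I_1)_{1.0}-A(I_1)_{0.1}}{N},\quad I_{10}=\frac{B(I_4)_{1.0}-A(I_4)_{0.1}}{N},\quad J_1=\frac{5I_1}{72},\quad J_4=\frac{I_4}{2160},\quad J_{10}=\frac{I_{10}}{12960}.$$ **Theorem 5.** Suppose that equation (1) is equivalent, under (local, smooth or holomorphic) invertible point transformations $\tilde x=\tilde x(x,y)$, $\tilde y=\tilde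 y(x,y)$, to the Painlevé IV equation with parameters $a,b$, $$PIV(a,b):\quad y''=\frac{1}{2y}y'^2+\frac32y^3+4xy^2+2(x^2-a)y+\frac by,\qquad y\neq 0.$$ Then $F=0$ on $D$; $A\ne0$ or $B\neq0$ on a dense subset of $D$; and on each of the sets $\{A\ne0\}$ and $\{B\ne0\}$, with the formulas that belong to it: $\Omega=0$ identically, $M\ne0$ on a dense subset, $Z\ne0$ on a dense subset, and, at every point with $N\ne0$, a) if $b=0$, then $K_0=0$, where $$K_0=4608J_1^4-3248J_1^3+808J_1^2+48000J_4J_1^2-16500J_4J_1-83J_1+1125J_4+125000J_4^2+3;$$ b) if $b\ne0$, then $K_n=0$, where $$\begin{aligned} K_n={}&2^{22}3^9J_1^9-2^{18}3^4\,7229J_1^8+2^{14}3^2(20412\cdot10^3J_4+795377)J_1^7\\ &+2^{10}\cdot3\cdot5(11664000J_{10}-293875200J_4-3170041)J_1^6\\ &+2^9\cdot3\cdot5(47628\cdot10^5J_4^2+347502500J_4-33816\cdot10^3J_{10}+1574799)J_1^5\\ &+2^8(550148750J_{10}+1701\cdot10^7J_{10}J_4-15275925\cdot10^4J_4^2-3187920625J_4-7217838)J_1^4\\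 &+2^5(5312667+437746\cdot10^4J_4+405\cdot10^7J_{10}^2+46305\cdot10^8J_4^3+479194\cdot10^6J_4^2-1168733750J_{10}-129705\cdot10^6J_{10}J_4)J_1^3\\ &+2^2(-2157057-3377467000J_4+12948575\cdot10^2J_{10}+6615\cdot10^9J_{10}J_4^2+33184\cdot10^7J_{10}J_4-697457\cdot10^6J_4^2-219765\cdot10^8J_4^3-23075\cdot10^6J_{10}^2)J_1^2\\ &+2^2\cdot5(9675\cdot10^5J_{10}^2-17852625J_{10}+33823650J_4-847425\cdot10^4J_{10}J_4-615125\cdot10^6J_{10}J_4^2+8080625\cdot10^5J_4^3+11864525\cdot10^3J_4^2+9261+7875\cdot10^7J_{10}^2J_4)J_1\\ &+5^4(15435J_{10}-21609J_4-12027400J_4^2-16033\cdot10^5J_4^3+11606\cdot10^3J_{10}J_4+5\cdot10^7J_{10}^3+343\cdot10^8J_4^4+20875\cdot10^5J_{10}J_4^2-58\cdot10^7J_{10}^2J_4-175\cdot10^4J_{10}^2). \end{aligned}$$ -/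

import Mathlib

open scoped ContDiff

noncomputable section

/-- The partial derivative `∂f/∂x` of a function of `z = (x, y)`. -/
def dx {𝕜 : Type*} [RCLike 𝕜] (f : 𝕜 × 𝕜 → 𝕜) (z : 𝕜 × 𝕜) : 𝕜 := fderiv 𝕜 f z (1, 0)

/-- The partial derivative `∂f/∂y` of a function of `z = (x, y)`. -/
def dy {𝕜 : Type*} [RCLike 𝕜] (f : 𝕜 × 𝕜 → 𝕜) (z : 𝕜 × 𝕜) : 𝕜 := fderiv 𝕜 f z (0, 1)

/-- An equation `y'' = P(x,y) + 3 Q(x,y) y' + 3 R(x,y) y'^2 + S(x,y) y'^3` whose coefficients are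
smooth (holomorphic for `𝕜 = ℂ`) functions on a nonempty open domain of the `(x, y)`-plane. -/
structure CubicODE (𝕜 : Type*) [RCLike 𝕜] where
  dom : Set (𝕜 × 𝕜)
  isOpen_dom : IsOpen dom
  nonempty_dom : dom.Nonempty
  P : 𝕜 × 𝕜 → 𝕜
  Q : 𝕜 × 𝕜 → 𝕜
  R : 𝕜 × 𝕜 → 𝕜
  S : 𝕜 × 𝕜 → 𝕜
  smooth_P : ContDiffOn 𝕜 ∞ P dom
  smooth_Q : ContDiffOn 𝕜 ∞ Q dom
  smooth_R : ContDiffOn 𝕜 ∞ R dom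
  smooth_S : ContDiffOn 𝕜 ∞ S dom

/-- First total derivative of `f(x, y(x))`, where `p` stands for `y'`. -/
def totalDeriv {𝕜 : Type*} [RCLike 𝕜] (f : 𝕜 × 𝕜 → 𝕜) (z : 𝕜 × 𝕜) (p : 𝕜) : 𝕜 :=
  dx f z + dy f z * p

/-- Second total derivative of `f(x, y(x))`, where `p`, `q` stand for `y'`, `y''`. -/
def totalDeriv₂ {𝕜 : Type*} [RCLike 𝕜] (f : 𝕜 × 𝕜 → 𝕜) (z : 𝕜 × 𝕜) (p q : 𝕜) : 𝕜 :=
  dx (dx f) z + 2 * dx (dy f) z * p + dy (dy f) z * p ^ 2 + dy f z * q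

/-- The value of `ỹ' = dỹ/dx̃` after the change of variables `(x̃, ỹ) = T(x, y)`, at the 1-jet
`(x, y, p)`. -/
def newSlope {𝕜 : Type*} [RCLike 𝕜] (T : 𝕜 × 𝕜 → 𝕜 × 𝕜) (z : 𝕜 × 𝕜) (p : 𝕜) : 𝕜 :=
  totalDeriv (fun w => (T w).2) z p / totalDeriv (fun w => (T w).1) z p

/-- The value of `ỹ'' = d²ỹ/dx̃²` after the change of variables `(x̃, ỹ) = T(x, y)`, at the 2-jet
`(x, y, p, q)`. -/
def newSecond {𝕜 : Type*} [RCLike 𝕜] (T : 𝕜 × 𝕜 → 𝕜 × 𝕜) (z : 𝕜 × 𝕜) (p q : 𝕜) : 𝕜 :=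
  (totalDeriv (fun w => (T w).1) z p * totalDeriv₂ (fun w => (T w).2) z p q
    - totalDeriv (fun w => (T w).2) z p * totalDeriv₂ (fun w => (T w).1) z p q)
      / totalDeriv (fun w => (T w).1) z p ^ 3

/-- The two coordinate patches `A ≠ 0` and `B ≠ 0` of the intermediate degeneration case. -/
inductive Branch : Type
  | A
  | B

/-- `f` is not identically zero near any point of `s`: its non-zeros are dense in `s`. -/
def NotIdenticallyZeroOn {𝕜 : Type*} [RCLike 𝕜] (f : 𝕜 × 𝕜 → 𝕜) (s : Set (𝕜 × 𝕜)) : Prop :=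
  s ⊆ closure {z | z ∈ s ∧ f z ≠ 0}

namespace CubicODE

variable {𝕜 : Type*} [RCLike 𝕜]

/-- The right-hand side of the equation, `p` standing for `y'`. -/
def rhs (E : CubicODE 𝕜) (z : 𝕜 × 𝕜) (p : 𝕜) : 𝕜 :=
  E.P z + 3 * E.Q z * p + 3 * E.R z * p ^ 2 + E.S z * p ^ 3

/-- `T` is a point transformation, that is a diffeomorphism of an open part of `E.dom` onto an open
part of `E'.dom`, smooth (holomorphic) in both directions, and it transforms `E` into `E'`: a
2-jet `(x, y, y', y'')` satisfies `E` if and only if its image `(x̃, ỹ, ỹ', ỹ'')` satisfies `E'`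
(for all slopes for which the image is not vertical). -/
def TransformsInto (E E' : CubicODE 𝕜) (T : OpenPartialHomeomorph (𝕜 × 𝕜) (𝕜 × 𝕜)) : Prop :=
  T.source ⊆ E.dom ∧ T.target ⊆ E'.dom ∧
  ContDiffOn 𝕜 ∞ T T.source ∧ ContDiffOn 𝕜 ∞ T.symm T.target ∧
  ∀ z ∈ T.source, ∀ p q : 𝕜, totalDeriv (fun w => (T w).1) z p ≠ 0 →
    (q = E.rhs z p ↔ newSecond T z p q = E'.rhs (T z) (newSlope T z p))

/-- `E` is (locally) point-equivalent to `E'`: around every point of its domain, `E` is carried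
into `E'` by a point transformation. A transformation defined on all of `E.dom` is a special
case. -/
def PointEquivalent (E E' : CubicODE 𝕜) : Prop :=
  ∀ z ∈ E.dom, ∃ T : OpenPartialHomeomorph (𝕜 × 𝕜) (𝕜 × 𝕜), z ∈ T.source ∧ E.TransformsInto E' T

/-- First component of the pseudocovectorial field `α`, of weight 1. -/
def A (E : CubicODE 𝕜) (z : 𝕜 × 𝕜) : 𝕜 :=
  dy (dy E.P) z - 2 * dx (dy E.Q) z + dx (dx E.R) z + 2 * E.P z * dx E.S z + E.S z * dx E.P z
    - 3 * E.P z * dy E.R z - 3 * E.R z * dy E.P z - 3 * E.Q z * dx E.R z + 6 * E.Q z * dy E.Q z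

/-- Second component of the pseudocovectorial field `α`, of weight 1. -/
def B (E : CubicODE 𝕜) (z : 𝕜 × 𝕜) : 𝕜 :=
  dx (dx E.S) z - 2 * dx (dy E.R) z + dy (dy E.Q) z - 2 * E.S z * dy E.P z - E.P z * dy E.S z
    + 3 * E.S z * dx E.Q z + 3 * E.Q z * dx E.S z + 3 * E.R z * dy E.Q z - 6 * E.R z * dx E.R z

/-- First component of the pseudovectorial field `β`, of weight 4. -/
def G (E : CubicODE 𝕜) (z : 𝕜 × 𝕜) : 𝕜 :=
  -E.B z * dx E.B z - 3 * E.A z * dy E.B z + 4 * E.B z * dy E.A z + 3 * E.S z * E.A z ^ 2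
    - 6 * E.R z * E.B z * E.A z + 3 * E.Q z * E.B z ^ 2

/-- Second component of the pseudovectorial field `β`, of weight 4. -/
def H (E : CubicODE 𝕜) (z : 𝕜 × 𝕜) : 𝕜 :=
  -E.A z * dy E.A z - 3 * E.B z * dx E.A z + 4 * E.A z * dx E.B z - 3 * E.P z * E.B z ^ 2
    + 6 * E.Q z * E.A z * E.B z - 3 * E.R z * E.A z ^ 2

/-- The fifth power `F^5` of the pseudoinvariant `F`, where `3 F^5 = A G + B H`; so `F = 0` means
that this vanishes. -/
def F5 (E : CubicODE 𝕜) (z : 𝕜 × 𝕜) : 𝕜 :=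
  (E.A z * E.G z + E.B z * E.H z) / 3

/-- The set of points with `A ≠ 0`, respectively `B ≠ 0`. -/
def patch (E : CubicODE 𝕜) : Branch → Set (𝕜 × 𝕜)
  | Branch.A => {z | z ∈ E.dom ∧ E.A z ≠ 0}
  | Branch.B => {z | z ∈ E.dom ∧ E.B z ≠ 0}

/-- The function `φ₁`, on `A ≠ 0` and on `B ≠ 0`. -/
def phi₁ (E : CubicODE 𝕜) : Branch → 𝕜 × 𝕜 → 𝕜
  | Branch.A => fun z =>
      -3 * (E.B z * E.P z + dx E.A z) / (5 * E.A z) + 3 / 5 * E.Q z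
  | Branch.B => fun z =>
      -3 * E.A z * (E.A z * E.S z - dy E.B z) / (5 * E.B z ^ 2)
        - 3 * (dy E.A z + dx E.B z - 3 * E.A z * E.R z) / (5 * E.B z) - 6 / 5 * E.Q z

/-- The function `φ₂`, on `A ≠ 0` and on `B ≠ 0`. -/
def phi₂ (E : CubicODE 𝕜) : Branch → 𝕜 × 𝕜 → 𝕜
  | Branch.A => fun z =>
      3 * E.B z * (E.B z * E.P z + dx E.A z) / (5 * E.A z ^ 2)
        - 3 * (dx E.B z + dy E.A z + 3 * E.B z * E.Q z) / (5 * E.A z) + 6 / 5 * E.R z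
  | Branch.B => fun z =>
      3 * (E.A z * E.S z - dy E.B z) / (5 * E.B z) - 3 / 5 * E.R z

/-- The pseudoinvariant `Ω`, of weight 1. -/
def Omega (E : CubicODE 𝕜) (br : Branch) (z : 𝕜 × 𝕜) : 𝕜 :=
  5 / 3 * (dy (E.phi₁ br) z - dx (E.phi₂ br) z)

/-- The pseudoinvariant `N`, of weight 2, that is the coefficient in `β = 3 N α`. -/
def N (E : CubicODE 𝕜) : Branch → 𝕜 × 𝕜 → 𝕜
  | Branch.A => fun z => -E.H z / (3 * E.A z)
  | Branch.B => fun z => E.G z / (3 * E.B z)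

/-- First component of the covariant differential of a pseudoinvariant `f` of weight `m`. -/
def nabla₁ (E : CubicODE 𝕜) (br : Branch) (m : ℕ) (f : 𝕜 × 𝕜 → 𝕜) (z : 𝕜 × 𝕜) : 𝕜 :=
  dx f z + m * E.phi₁ br z * f z

/-- Second component of the covariant differential of a pseudoinvariant `f` of weight `m`. -/
def nabla₂ (E : CubicODE 𝕜) (br : Branch) (m : ℕ) (f : 𝕜 × 𝕜 → 𝕜) (z : 𝕜 × 𝕜) : 𝕜 :=
  dy f z + m * E.phi₂ br z * f z

/-- First component of the field `ξ^i = d^{ij} ∇_j N`. -/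
def xi₁ (E : CubicODE 𝕜) (br : Branch) (z : 𝕜 × 𝕜) : 𝕜 := E.nabla₂ br 2 (E.N br) z

/-- Second component of the field `ξ^i = d^{ij} ∇_j N`. -/
def xi₂ (E : CubicODE 𝕜) (br : Branch) (z : 𝕜 × 𝕜) : 𝕜 := -E.nabla₁ br 2 (E.N br) z

/-- The pseudoinvariant `M = - α_i ξ^i`, of weight 4, where `α_1 = A` and `α_2 = B`. -/
def M (E : CubicODE 𝕜) (br : Branch) (z : 𝕜 × 𝕜) : 𝕜 :=
  -(E.A z * E.xi₁ br z + E.B z * E.xi₂ br z)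

/-- First component of the field `η^i = d^{ij} ∇_j M`. -/
def eta₁ (E : CubicODE 𝕜) (br : Branch) (z : 𝕜 × 𝕜) : 𝕜 := E.nabla₂ br 4 (E.M br) z

/-- Second component of the field `η^i = d^{ij} ∇_j M`. -/
def eta₂ (E : CubicODE 𝕜) (br : Branch) (z : 𝕜 × 𝕜) : 𝕜 := -E.nabla₁ br 4 (E.M br) z

/-- The pseudoinvariant `Z = d_{ij} η^i ξ^j`, of weight 7. -/
def Z (E : CubicODE 𝕜) (br : Branch) (z : 𝕜 × 𝕜) : 𝕜 :=
  E.eta₁ br z * E.xi₂ br z - E.eta₂ br z * E.xi₁ br z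

/-- The derivative `∇_α f / N` of an invariant `f`, where `α^1 = B` and `α^2 = -A`. -/
def alphaDeriv (E : CubicODE 𝕜) (br : Branch) (f : 𝕜 × 𝕜 → 𝕜) (z : 𝕜 × 𝕜) : 𝕜 :=
  (E.B z * dx f z - E.A z * dy f z) / E.N br z

/-- The invariant `I₁ = M / N²`. -/
def I1 (E : CubicODE 𝕜) (br : Branch) (z : 𝕜 × 𝕜) : 𝕜 := E.M br z / E.N br z ^ 2

/-- The invariant `I₄ = ∇_α I₁ / N`. -/
def I4 (E : CubicODE 𝕜) (br : Branch) : 𝕜 × 𝕜 → 𝕜 := E.alphaDeriv br (E.I1 br)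

/-- The invariant `I₁₀ = ∇_α I₄ / N`. -/
def I10 (E : CubicODE 𝕜) (br : Branch) : 𝕜 × 𝕜 → 𝕜 := E.alphaDeriv br (E.I4 br)

/-- The normalized invariant `J₁`. -/
def J1 (E : CubicODE 𝕜) (br : Branch) (z : 𝕜 × 𝕜) : 𝕜 := 5 * E.I1 br z / 72

/-- The normalized invariant `J₄`. -/
def J4 (E : CubicODE 𝕜) (br : Branch) (z : 𝕜 × 𝕜) : 𝕜 := E.I4 br z / 2160

/-- The normalized invariant `J₁₀`. -/
def J10 (E : CubicODE 𝕜) (br : Branch) (z : 𝕜 × 𝕜) : 𝕜 := E.I10 br z / 12960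

end CubicODE

/-- The Painlevé IV equation
`y'' = y'^2 / (2y) + (3/2) y^3 + 4 x y^2 + 2 (x^2 - a) y + b / y`, on the domain `y ≠ 0`. -/
def painleveIV {𝕜 : Type*} [RCLike 𝕜] (a b : 𝕜) : CubicODE 𝕜 where
  dom := {z | z.2 ≠ 0}
  isOpen_dom := isOpen_ne_fun continuous_snd continuous_const
  nonempty_dom := ⟨(0, 1), one_ne_zero⟩
  P := fun z => 3 / 2 * z.2 ^ 3 + 4 * z.1 * z.2 ^ 2 + 2 * (z.1 ^ 2 - a) * z.2 + b / z.2
  Q := fun _ => 0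
  R := fun z => 1 / (6 * z.2)
  S := fun _ => 0
  smooth_P := by
    refine ContDiffOn.add (ContDiff.contDiffOn (by fun_prop)) ?_
    exact contDiffOn_const.div contDiff_snd.contDiffOn (fun z hz => hz)
  smooth_Q := contDiffOn_const
  smooth_R := contDiffOn_const.div (contDiff_const.mul contDiff_snd).contDiffOn
    (fun z hz => mul_ne_zero (by norm_num) hz)
  smooth_S := contDiffOn_const

/-- The polynomial relation for `PIV(a, 0)`. -/
def K₀ {𝕜 : Type*} [RCLike 𝕜] (J₁ J₄ : 𝕜) : 𝕜 :=
  4608 * J₁ ^ 4 - 3248 * J₁ ^ 3 + 808 * J₁ ^ 2 + 48000 * J₄ * J₁ ^ 2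
    - 16500 * J₄ * J₁ - 83 * J₁ + 1125 * J₄ + 125000 * J₄ ^ 2 + 3

/-- The polynomial relation for `PIV(a, b)`, `b ≠ 0`. -/
def Kₙ {𝕜 : Type*} [RCLike 𝕜] (J₁ J₄ J₁₀ : 𝕜) : 𝕜 :=
  2 ^ 22 * 3 ^ 9 * J₁ ^ 9
  - 2 ^ 18 * 3 ^ 4 * 7229 * J₁ ^ 8
  + 2 ^ 14 * 3 ^ 2 * (20412 * 10 ^ 3 * J₄ + 795377) * J₁ ^ 7
  + 2 ^ 10 * 3 * 5 * (11664000 * J₁₀ - 293875200 * J₄ - 3170041) * J₁ ^ 6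
  + 2 ^ 9 * 3 * 5 * (47628 * 10 ^ 5 * J₄ ^ 2 + 347502500 * J₄ - 33816 * 10 ^ 3 * J₁₀
      + 1574799) * J₁ ^ 5
  + 2 ^ 8 * (550148750 * J₁₀ + 1701 * 10 ^ 7 * J₁₀ * J₄ - 15275925 * 10 ^ 4 * J₄ ^ 2
      - 3187920625 * J₄ - 7217838) * J₁ ^ 4
  + 2 ^ 5 * (5312667 + 437746 * 10 ^ 4 * J₄ + 405 * 10 ^ 7 * J₁₀ ^ 2
      + 46305 * 10 ^ 8 * J₄ ^ 3 + 479194 * 10 ^ 6 * J₄ ^ 2 - 1168733750 * J₁₀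
      - 129705 * 10 ^ 6 * J₁₀ * J₄) * J₁ ^ 3
  + 2 ^ 2 * (-2157057 - 3377467000 * J₄ + 12948575 * 10 ^ 2 * J₁₀
      + 6615 * 10 ^ 9 * J₁₀ * J₄ ^ 2 + 33184 * 10 ^ 7 * J₁₀ * J₄ - 697457 * 10 ^ 6 * J₄ ^ 2
      - 219765 * 10 ^ 8 * J₄ ^ 3 - 23075 * 10 ^ 6 * J₁₀ ^ 2) * J₁ ^ 2
  + 2 ^ 2 * 5 * (9675 * 10 ^ 5 * J₁₀ ^ 2 - 17852625 * J₁₀ + 33823650 * J₄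
      - 847425 * 10 ^ 4 * J₁₀ * J₄ - 615125 * 10 ^ 6 * J₁₀ * J₄ ^ 2
      + 8080625 * 10 ^ 5 * J₄ ^ 3 + 11864525 * 10 ^ 3 * J₄ ^ 2 + 9261
      + 7875 * 10 ^ 7 * J₁₀ ^ 2 * J₄) * J₁
  + 5 ^ 4 * (15435 * J₁₀ - 21609 * J₄ - 12027400 * J₄ ^ 2 - 16033 * 10 ^ 5 * J₄ ^ 3
      + 11606 * 10 ^ 3 * J₁₀ * J₄ + 5 * 10 ^ 7 * J₁₀ ^ 3 + 343 * 10 ^ 8 * J₄ ^ 4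
      + 20875 * 10 ^ 5 * J₁₀ * J₄ ^ 2 - 58 * 10 ^ 7 * J₁₀ ^ 2 * J₄
      - 175 * 10 ^ 4 * J₁₀ ^ 2)

end

/-! Every quantity arises from P, Q, R, S by differentiation and rational operations, so the theorem
is a statement of differential algebra. Near a point one works in the ring of smooth germs with its
two commuting derivations. A point transformation onto PIV(a, b) supplies germs X, Y and a second
commuting pair ∂/∂X, ∂/∂Y on the same ring, so both equations are compared inside one ring
(`TransformsInto.exists_frame`).

Covariance carries the proof. The functions φ₁, φ₂ solve three linear equations, `IsGauge`, which
mention no patch: solvability forces AG + BH = 0, that is F = 0, and where A ≠ 0 or B ≠ 0 the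
formulas of that patch give the solution. The field α = (A, B) has weight 1, and (φ₁, φ₂) transforms
as a covector minus d log J, where J is the Jacobian (`CoordChange.covariant`). N is −5/6 of the
covariant curl of α. Hence Ω, N, M, Z acquire the factors J, J², J⁴, J⁷, while I₁, I₄, I₁₀ are
unchanged.

What remains is PIV itself, where B = 0. Put t = x/y and s = b/y⁴. Then 2A/y, N, M and A²Z are
polynomials in t and s, free of a, and 2A ∂/∂y acts on functions of t, s as −g(t∂_t + 4s∂_s) with g
= 15 + 12t + 6s (`invariants_eq`). So J₁, J₄, J₁₀ are rational in two parameters and satisfy the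
relation K_n; for b = 0 one has s = 0, and already J₁, J₄ satisfy K₀. Both relations are checked by
substitution.

For density, α, M and Z can vanish only where a certain polynomial in t does, with coefficients
depending on s and a constant nonzero leading coefficient. On a line y = const, s is fixed, so there
are finitely many such points. -/

noncomputable section

open Filter Topology

/-! ### Germs of smooth functions and their derivations -/

/-- The ring of germs at `z` of smooth functions of two variables. -/
def SmoothGerm {𝕜 : Type*} [RCLike 𝕜] (z : 𝕜 × 𝕜) : Subring (Germ (𝓝 z) 𝕜) where
  carrier := {g | ∃ f : 𝕜 × 𝕜 → 𝕜, ContDiffAt 𝕜 ∞ f z ∧ (f : Germ (𝓝 z) 𝕜) = g}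
  mul_mem' := by
    rintro _ _ ⟨f, hf, rfl⟩ ⟨g, hg, rfl⟩
    exact ⟨f * g, hf.mul hg, rfl⟩
  one_mem' := ⟨1, contDiffAt_const, rfl⟩
  add_mem' := by
    rintro _ _ ⟨f, hf, rfl⟩ ⟨g, hg, rfl⟩
    exact ⟨f + g, hf.add hg, rfl⟩
  zero_mem' := ⟨0, contDiffAt_const, rfl⟩
  neg_mem' := by
    rintro _ ⟨f, hf, rfl⟩
    exact ⟨-f, hf.neg, rfl⟩

namespace SmoothGerm

variable {𝕜 : Type*} [RCLike 𝕜] {z : 𝕜 × 𝕜}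

/-- The function `f` is a representative of the germ `g`. -/
def Rep (f : 𝕜 × 𝕜 → 𝕜) (g : SmoothGerm z) : Prop := (f : Germ (𝓝 z) 𝕜) = g.1

/-- The germ of a function that is smooth at `z`. -/
def of (f : 𝕜 × 𝕜 → 𝕜) (hf : ContDiffAt 𝕜 ∞ f z) : SmoothGerm z := ⟨f, f, hf, rfl⟩

theorem rep_of (f : 𝕜 × 𝕜 → 𝕜) (hf : ContDiffAt 𝕜 ∞ f z) : Rep f (of f hf) := rfl

/-- A constant, as a germ. -/
def const (z : 𝕜 × 𝕜) (c : 𝕜) : SmoothGerm z := of (fun _ => c) contDiffAt_const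

/-- The value of a germ at the base point. -/
def eval (z : 𝕜 × 𝕜) : SmoothGerm z →+* 𝕜 := Germ.valueRingHom.comp (SmoothGerm z).subtype

theorem exists_rep (g : SmoothGerm z) : ∃ f, ContDiffAt 𝕜 ∞ f z ∧ Rep f g := g.2

namespace Rep

variable {f f₁ f₂ : 𝕜 × 𝕜 → 𝕜} {g g₁ g₂ : SmoothGerm z}

theorem congr (h : Rep f₁ g) (hf : f₂ =ᶠ[𝓝 z] f₁) : Rep f₂ g := (Germ.coe_eq.2 hf).trans h

theorem eventuallyEq (h₁ : Rep f₁ g) (h₂ : Rep f₂ g) : f₁ =ᶠ[𝓝 z] f₂ :=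
  Germ.coe_eq.1 (h₁.trans (Eq.symm h₂))

theorem eq_iff (h₁ : Rep f₁ g₁) (h₂ : Rep f₂ g₂) : g₁ = g₂ ↔ f₁ =ᶠ[𝓝 z] f₂ := by
  rw [Subtype.ext_iff, ← Germ.coe_eq]
  exact ⟨fun h => h₁.trans (h.trans (Eq.symm h₂)), fun h => (Eq.symm h₁).trans (h.trans h₂)⟩

theorem contDiffAt (h : Rep f g) : ContDiffAt 𝕜 ∞ f z := by
  obtain ⟨f', hf', h'⟩ := g.2
  exact hf'.congr_of_eventuallyEq (Germ.coe_eq.1 (h.trans (Eq.symm h')))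

theorem eval_eq (h : Rep f g) : eval z g = f z :=
  (congrArg Germ.value (Eq.symm h) : _)

theorem const (c : 𝕜) : Rep (fun _ => c) (SmoothGerm.const z c) := rfl

theorem add (h₁ : Rep f₁ g₁) (h₂ : Rep f₂ g₂) : Rep (fun w => f₁ w + f₂ w) (g₁ + g₂) :=
  congrArg₂ (· + ·) h₁ h₂

theorem sub (h₁ : Rep f₁ g₁) (h₂ : Rep f₂ g₂) : Rep (fun w => f₁ w - f₂ w) (g₁ - g₂) :=
  congrArg₂ (· - ·) h₁ h₂

theorem mul (h₁ : Rep f₁ g₁) (h₂ : Rep f₂ g₂) : Rep (fun w => f₁ w * f₂ w) (g₁ * g₂) :=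
  congrArg₂ (· * ·) h₁ h₂

theorem neg (h : Rep f g) : Rep (fun w => -f w) (-g) := congrArg (-·) h

theorem pow (h : Rep f g) (n : ℕ) : Rep (fun w => f w ^ n) (g ^ n) := congrArg (· ^ n) h

theorem natCast (n : ℕ) : Rep (fun _ => (n : 𝕜)) (n : SmoothGerm z) := rfl

theorem ofNat (n : ℕ) [n.AtLeastTwo] :
    Rep (fun _ => (OfNat.ofNat n : 𝕜)) (OfNat.ofNat n : SmoothGerm z) := rfl

theorem zero : Rep (fun _ => 0) (0 : SmoothGerm z) := rfl

theorem one : Rep (fun _ => 1) (1 : SmoothGerm z) := rfl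

/-- Division of functions is total, so the quotient germ is pinned down by `g * g₂ = g₁`;
invertibility of `g₂` makes `f₂` nonzero near `z`. -/
theorem div (h₁ : Rep f₁ g₁) (h₂ : Rep f₂ g₂) (h : g * g₂ = g₁) (h0 : IsUnit g₂) :
    Rep (fun w => f₁ w / f₂ w) g := by
  obtain ⟨f, -, hf⟩ := (exists_rep g)
  obtain ⟨u, hu⟩ := h0.exists_right_inv
  obtain ⟨k, -, hk⟩ := (exists_rep u)
  refine hf.congr ?_
  filter_upwards [((h₂.mul hk).eq_iff one).1 hu, ((hf.mul h₂).eq_iff h₁).1 h] with w h1 h2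
  rw [← h2, mul_div_cancel_right₀ _ (left_ne_zero_of_mul_eq_one h1)]

theorem isUnit (h : Rep f g) (hz : f z ≠ 0) : IsUnit g := by
  have hf := h.contDiffAt
  refine IsUnit.of_mul_eq_one (of (fun w => (f w)⁻¹) (hf.inv hz)) ?_
  refine ((h.mul (rep_of _ _)).eq_iff one).2 ?_
  filter_upwards [hf.continuousAt.eventually_ne hz] with w hw
  exact mul_inv_cancel₀ hw

end Rep

theorem contDiffAt_fderiv_apply {f : 𝕜 × 𝕜 → 𝕜} (hf : ContDiffAt 𝕜 ∞ f z) (v : 𝕜 × 𝕜) :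
    ContDiffAt 𝕜 ∞ (fun w => fderiv 𝕜 f w v) z :=
  (hf.fderiv_right (m := ∞) (by simp)).clm_apply contDiffAt_const

/-- The derivative of germs in the direction `v`. -/
def deriv (z v : 𝕜 × 𝕜) : Derivation ℤ (SmoothGerm z) (SmoothGerm z) :=
  Derivation.mk'
    (AddMonoidHom.toIntLinearMap
      -- The chosen representative is harmless: functions that agree near `z` have derivatives that
      -- agree near `z`.
      { toFun := fun g => of (fun w => fderiv 𝕜 (exists_rep g).choose w v)
          (contDiffAt_fderiv_apply (exists_rep g).choose_spec.1 v)
        map_zero' := by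
          have h := (exists_rep (0 : SmoothGerm z)).choose_spec
          refine ((rep_of _ _).eq_iff Rep.zero).2 ?_
          filter_upwards [(h.2.eventuallyEq Rep.zero).fderiv (𝕜 := 𝕜)] with w hw
          rw [hw]; simp
        map_add' := fun g₁ g₂ => by
          have h := (exists_rep (g₁ + g₂)).choose_spec
          have h₁ := (exists_rep g₁).choose_spec
          have h₂ := (exists_rep g₂).choose_spec
          refine ((rep_of _ _).eq_iff ((rep_of _ _).add (rep_of _ _))).2 ?_
          filter_upwards [(h.2.eventuallyEq (h₁.2.add h₂.2)).fderiv (𝕜 := 𝕜),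
            (h₁.1.of_le (m := 1) (by simp)).eventually (by simp),
            (h₂.1.of_le (m := 1) (by simp)).eventually (by simp)] with w hw hw₁ hw₂
          rw [hw, fderiv_fun_add (hw₁.differentiableAt (by simp))
            (hw₂.differentiableAt (by simp))]
          rfl })
    (fun g₁ g₂ => by
      have h := (exists_rep (g₁ * g₂)).choose_spec
      have h₁ := (exists_rep g₁).choose_spec
      have h₂ := (exists_rep g₂).choose_spec
      refine ((rep_of _ (contDiffAt_fderiv_apply h.1 v)).eq_iff
        ((h₁.2.mul (rep_of _ (contDiffAt_fderiv_apply h₂.1 v))).add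
          (h₂.2.mul (rep_of _ (contDiffAt_fderiv_apply h₁.1 v))))).2 ?_
      filter_upwards [(h.2.eventuallyEq (h₁.2.mul h₂.2)).fderiv (𝕜 := 𝕜),
        (h₁.1.of_le (m := 1) (by simp)).eventually (by simp),
        (h₂.1.of_le (m := 1) (by simp)).eventually (by simp)] with w hw hw₁ hw₂
      rw [hw, fderiv_fun_mul (hw₁.differentiableAt (by simp))
        (hw₂.differentiableAt (by simp))]
      rfl)

theorem Rep.fderiv {f : 𝕜 × 𝕜 → 𝕜} {g : SmoothGerm z} (h : Rep f g) (v : 𝕜 × 𝕜) :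
    Rep (fun w => fderiv 𝕜 f w v) (deriv z v g) := by
  refine (rep_of _ (contDiffAt_fderiv_apply (exists_rep g).choose_spec.1 v)).congr ?_
  filter_upwards [(h.eventuallyEq (exists_rep g).choose_spec.2).fderiv (𝕜 := 𝕜)] with w hw
  rw [hw]

theorem deriv_const (v : 𝕜 × 𝕜) (c : 𝕜) : deriv z v (const z c) = 0 := by
  refine (((Rep.const c).fderiv v).eq_iff Rep.zero).2 (Eventually.of_forall fun w => ?_)
  simp

theorem deriv_comm (u v : 𝕜 × 𝕜) (g : SmoothGerm z) :
    deriv z u (deriv z v g) = deriv z v (deriv z u g) := by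
  obtain ⟨f, hf, h⟩ := (exists_rep g)
  refine (((h.fderiv v).fderiv u).eq_iff ((h.fderiv u).fderiv v)).2 ?_
  filter_upwards [(contDiffAt_infty.1 hf 2).eventually (by simp)] with w hw
  have hd : DifferentiableAt 𝕜 (_root_.fderiv 𝕜 f) w :=
    (hw.fderiv_right (m := 1) (by norm_num)).differentiableAt (by simp)
  have hs : IsSymmSndFDerivAt 𝕜 f w := hw.isSymmSndFDerivAt (by simp)
  rw [fderiv_clm_apply hd (differentiableAt_const _),
    fderiv_clm_apply hd (differentiableAt_const _)]
  simpa using hs u v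

/-- The partial derivative `∂/∂x` of germs. -/
def ddx (z : 𝕜 × 𝕜) : Derivation ℤ (SmoothGerm z) (SmoothGerm z) := deriv z (1, 0)

/-- The partial derivative `∂/∂y` of germs. -/
def ddy (z : 𝕜 × 𝕜) : Derivation ℤ (SmoothGerm z) (SmoothGerm z) := deriv z (0, 1)

theorem Rep.dx {f : 𝕜 × 𝕜 → 𝕜} {g : SmoothGerm z} (h : Rep f g) : Rep (dx f) (ddx z g) :=
  h.fderiv _

theorem Rep.dy {f : 𝕜 × 𝕜 → 𝕜} {g : SmoothGerm z} (h : Rep f g) : Rep (dy f) (ddy z g) :=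
  h.fderiv _

theorem ddy_ddx (g : SmoothGerm z) : ddy z (ddx z g) = ddx z (ddy z g) := deriv_comm _ _ g

theorem isUnit_const {c : 𝕜} (hc : c ≠ 0) : IsUnit (const z c) := (Rep.const c).isUnit hc

theorem isUnit_ofNat (n : ℕ) [n.AtLeastTwo] : IsUnit (OfNat.ofNat n : SmoothGerm z) :=
  isUnit_const (c := (OfNat.ofNat n : 𝕜)) (OfNat.ofNat_ne_zero n)

end SmoothGerm

/-! ### Differential algebra of the coefficients; exchange of coordinates -/

/-- A pair of commuting derivations of a commutative ring. -/
structure Frame (𝒪 : Type*) [CommRing 𝒪] where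
  d₁ : Derivation ℤ 𝒪 𝒪
  d₂ : Derivation ℤ 𝒪 𝒪
  comm : ∀ f, d₂ (d₁ f) = d₁ (d₂ f)

/-- The coefficients of an equation `y'' = P + 3 Q y' + 3 R y'^2 + S y'^3`. -/
structure Coeffs (𝒪 : Type*) where
  P : 𝒪
  Q : 𝒪
  R : 𝒪
  S : 𝒪

/-- The coefficients after exchange of the two coordinates. -/
def Coeffs.swap {𝒪 : Type*} [CommRing 𝒪] (c : Coeffs 𝒪) : Coeffs 𝒪 := ⟨-c.S, -c.R, -c.Q, -c.P⟩

theorem Derivation.map_ofNat_eq_zero {𝒪 : Type*} [CommRing 𝒪] (D : Derivation ℤ 𝒪 𝒪) (n : ℕ)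
    [n.AtLeastTwo] : D (ofNat(n) : 𝒪) = 0 := D.map_natCast n

theorem Derivation.map_mul_eq {𝒪 : Type*} [CommRing 𝒪] (D : Derivation ℤ 𝒪 𝒪) (f g : 𝒪) :
    D (f * g) = f * D g + g * D f := D.leibniz f g

theorem Derivation.map_pow_eq {𝒪 : Type*} [CommRing 𝒪] (D : Derivation ℤ 𝒪 𝒪) (f : 𝒪) (n : ℕ) :
    D (f ^ n) = n * f ^ (n - 1) * D f := by
  rw [D.leibniz_pow, nsmul_eq_mul, smul_eq_mul, mul_assoc]

namespace Frame

variable {𝒪 : Type*} [CommRing 𝒪]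

/-- The frame after exchange of the two coordinates. -/
def swap (D : Frame 𝒪) : Frame 𝒪 := ⟨D.d₂, D.d₁, fun f => (D.comm f).symm⟩

/-- First component of the field `α`. -/
def A (D : Frame 𝒪) (c : Coeffs 𝒪) : 𝒪 :=
  D.d₂ (D.d₂ c.P) - 2 * D.d₁ (D.d₂ c.Q) + D.d₁ (D.d₁ c.R) + 2 * c.P * D.d₁ c.S + c.S * D.d₁ c.P
    - 3 * c.P * D.d₂ c.R - 3 * c.R * D.d₂ c.P - 3 * c.Q * D.d₁ c.R + 6 * c.Q * D.d₂ c.Q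

/-- Second component of the field `α`. -/
def B (D : Frame 𝒪) (c : Coeffs 𝒪) : 𝒪 :=
  D.d₁ (D.d₁ c.S) - 2 * D.d₁ (D.d₂ c.R) + D.d₂ (D.d₂ c.Q) - 2 * c.S * D.d₂ c.P - c.P * D.d₂ c.S
    + 3 * c.S * D.d₁ c.Q + 3 * c.Q * D.d₁ c.S + 3 * c.R * D.d₂ c.Q - 6 * c.R * D.d₁ c.R

/-- The sign is the Jacobian −1 of the exchange, as α has weight 1. -/
theorem A_swap (D : Frame 𝒪) (c : Coeffs 𝒪) : D.swap.A c.swap = -D.B c := by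
  simp only [A, B, swap, Coeffs.swap, map_neg, D.comm]; ring

theorem B_swap (D : Frame 𝒪) (c : Coeffs 𝒪) : D.swap.B c.swap = -D.A c := by
  simp only [A, B, swap, Coeffs.swap, map_neg, D.comm]; ring

/-! ### Fiber changes (x, y) ↦ (x, v) -/

/-- The frames `D` and `E` belong to coordinates `(x, y)` and `(x, v)`; `v₁`, `v₂` are the partial
derivatives of `v` and `l₁`, `l₂` those of `log v₂`. -/
structure FiberChange (D E : Frame 𝒪) (v₁ v₂ l₁ l₂ : 𝒪) : Prop where
  d₁_eq : ∀ f, D.d₁ f = E.d₁ f + v₁ * E.d₂ f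
  d₂_eq : ∀ f, D.d₂ f = v₂ * E.d₂ f
  isUnit : IsUnit v₂
  d₂_v₁ : D.d₂ v₁ = l₁ * v₂
  d₁_v₂ : D.d₁ v₂ = l₁ * v₂
  d₂_v₂ : D.d₂ v₂ = l₂ * v₂
  d₂_l₁ : D.d₂ l₁ = D.d₁ l₂

/-- The coefficients `c` are obtained from `c'` by the substitution that defines a fiber change. -/
structure FiberLaw (D : Frame 𝒪) (v₁ v₂ l₁ l₂ : 𝒪) (c c' : Coeffs 𝒪) : Prop where
  P_eq : v₂ * c.P = c'.P + 3 * c'.Q * v₁ + 3 * c'.R * v₁ ^ 2 + c'.S * v₁ ^ 3 - D.d₁ v₁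
  Q_eq : 3 * c.Q = 3 * c'.Q + 6 * c'.R * v₁ + 3 * c'.S * v₁ ^ 2 - 2 * l₁
  R_eq : 3 * c.R = 3 * c'.R * v₂ + 3 * c'.S * v₁ * v₂ - l₂
  S_eq : c.S = c'.S * v₂ ^ 2

variable {D E : Frame 𝒪} {v₁ v₂ l₁ l₂ : 𝒪} {c c' : Coeffs 𝒪}

/-- The substitution law gives v₂P, 3Q, 3R and S without denominators, so 9v₂A expands polynomially
in the new data, and 9v₂ is a unit. -/
theorem FiberChange.A_eq (h : FiberChange D E v₁ v₂ l₁ l₂) (hc : FiberLaw D v₁ v₂ l₁ l₂ c c')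
    (h3 : IsUnit (3 : 𝒪)) : D.A c = v₂ * (E.A c' + v₁ * E.B c') := by
  -- The values p, q, r of v₂P, 3Q, 3R stay opaque while A is rewritten through them, which keeps
  -- `key` small; they are expanded only at the end.
  obtain ⟨p, hpd⟩ : ∃ p, p =
    c'.P + 3 * c'.Q * v₁ + 3 * c'.R * v₁ ^ 2 + c'.S * v₁ ^ 3 - D.d₁ v₁ := ⟨_, rfl⟩
  obtain ⟨q, hqd⟩ : ∃ q, q = 3 * c'.Q + 6 * c'.R * v₁ + 3 * c'.S * v₁ ^ 2 - 2 * l₁ := ⟨_, rfl⟩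
  obtain ⟨r, hrd⟩ : ∃ r, r = 3 * c'.R * v₂ + 3 * c'.S * v₁ * v₂ - l₂ := ⟨_, rfl⟩
  have hp := hc.P_eq.trans hpd.symm
  have hq := hc.Q_eq.trans hqd.symm
  have hr := hc.R_eq.trans hrd.symm
  have hp1 := congrArg D.d₁ hp
  have hp2 := congrArg D.d₂ hp
  have hp22 := congrArg D.d₂ hp2
  have hq2 := congrArg D.d₂ hq
  have hq12 := congrArg D.d₁ hq2
  have hr1 := congrArg D.d₁ hr
  have hr2 := congrArg D.d₂ hr
  have hr11 := congrArg D.d₁ hr1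
  have key : 9 * v₂ * D.A c = 9 * (D.d₂ (D.d₂ p) - 2 * l₂ * D.d₂ p - D.d₂ l₂ * p + l₂ ^ 2 * p)
      - 6 * v₂ * D.d₁ (D.d₂ q) + 3 * v₂ * D.d₁ (D.d₁ r) + 18 * p * D.d₁ c.S
      + 9 * c.S * (D.d₁ p - l₁ * p) - 9 * p * D.d₂ r - 9 * r * (D.d₂ p - l₂ * p)
      - 3 * v₂ * q * D.d₁ r + 6 * v₂ * q * D.d₂ q := by
    simp only [map_add, Derivation.map_mul_eq, Derivation.map_ofNat_eq_zero, h.d₁_v₂, h.d₂_v₂,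
      mul_zero, add_zero] at hp1 hp2 hp22 hq2 hq12 hr1 hr2 hr11
    simp only [A]
    linear_combination 9 * hp22 - 18 * l₂ * hp2 + 9 * (l₂ ^ 2 - D.d₂ l₂) * hp - 6 * v₂ * hq12
      + 3 * v₂ * hr11 + 18 * D.d₁ c.S * hp + 9 * c.S * (hp1 - l₁ * hp) - 27 * D.d₂ c.R * hp
      - 9 * p * hr2 - 9 * r * (hp2 - l₂ * hp) - 9 * v₂ * D.d₂ c.P * hr
      - 3 * v₂ * q * hr1 - 9 * v₂ * D.d₁ c.R * hq + 6 * v₂ * q * hq2 + 18 * v₂ * D.d₂ c.Q * hq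
  have h9 : IsUnit (9 * v₂) := by
    have : (9 : 𝒪) = 3 * 3 := by norm_num
    rw [this]
    exact (h3.mul h3).mul h.isUnit
  refine h9.mul_left_cancel ?_
  rw [key, hc.S_eq]
  subst hpd hqd hrd
  simp only [A, B, map_add, map_sub, Derivation.map_mul_eq, Derivation.map_pow_eq,
    Derivation.map_ofNat_eq_zero, Derivation.map_natCast, map_zero, h.d₁_v₂, h.d₂_v₂, h.d₂_v₁, h.d₂_l₁, D.comm, E.comm,
    h.d₁_eq c'.P, h.d₁_eq c'.Q, h.d₁_eq c'.R, h.d₁_eq c'.S,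
    h.d₂_eq c'.P, h.d₂_eq c'.Q, h.d₂_eq c'.R, h.d₂_eq c'.S,
    h.d₁_eq (E.d₁ c'.R), h.d₁_eq (E.d₁ c'.S),
    h.d₁_eq (E.d₂ c'.Q), h.d₁_eq (E.d₂ c'.R), h.d₁_eq (E.d₂ c'.S),
    h.d₂_eq (E.d₂ c'.P), h.d₂_eq (E.d₂ c'.Q), h.d₂_eq (E.d₂ c'.R), h.d₂_eq (E.d₂ c'.S)]
  push_cast
  ring

theorem FiberChange.B_eq (h : FiberChange D E v₁ v₂ l₁ l₂) (hc : FiberLaw D v₁ v₂ l₁ l₂ c c')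
    (h3 : IsUnit (3 : 𝒪)) : D.B c = v₂ ^ 2 * E.B c' := by
  obtain ⟨p, hpd⟩ : ∃ p, p =
    c'.P + 3 * c'.Q * v₁ + 3 * c'.R * v₁ ^ 2 + c'.S * v₁ ^ 3 - D.d₁ v₁ := ⟨_, rfl⟩
  obtain ⟨q, hqd⟩ : ∃ q, q = 3 * c'.Q + 6 * c'.R * v₁ + 3 * c'.S * v₁ ^ 2 - 2 * l₁ := ⟨_, rfl⟩
  obtain ⟨r, hrd⟩ : ∃ r, r = 3 * c'.R * v₂ + 3 * c'.S * v₁ * v₂ - l₂ := ⟨_, rfl⟩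
  have hp := hc.P_eq.trans hpd.symm
  have hq := hc.Q_eq.trans hqd.symm
  have hr := hc.R_eq.trans hrd.symm
  have hp2 := congrArg D.d₂ hp
  have hq1 := congrArg D.d₁ hq
  have hq2 := congrArg D.d₂ hq
  have hq22 := congrArg D.d₂ hq2
  have hr1 := congrArg D.d₁ hr
  have hr2 := congrArg D.d₂ hr
  have hr12 := congrArg D.d₁ hr2
  have key : 9 * v₂ * D.B c = 9 * v₂ * D.d₁ (D.d₁ c.S) - 6 * v₂ * D.d₁ (D.d₂ r)
      + 3 * v₂ * D.d₂ (D.d₂ q) - 18 * c.S * (D.d₂ p - l₂ * p) - 9 * p * D.d₂ c.S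
      + 9 * v₂ * c.S * D.d₁ q + 9 * v₂ * q * D.d₁ c.S + 3 * v₂ * r * D.d₂ q
      - 6 * v₂ * r * D.d₁ r := by
    simp only [Derivation.map_mul_eq, Derivation.map_ofNat_eq_zero, h.d₂_v₂,
      mul_zero, add_zero] at hp2 hq1 hq2 hq22 hr1 hr12
    simp only [B]
    linear_combination -6 * v₂ * hr12 + 3 * v₂ * hq22 - 18 * c.S * (hp2 - l₂ * hp)
      - 9 * D.d₂ c.S * hp + 9 * v₂ * c.S * hq1 + 9 * v₂ * D.d₁ c.S * hq + 3 * v₂ * r * hq2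
      + 9 * v₂ * D.d₂ c.Q * hr - 6 * v₂ * r * hr1 - 18 * v₂ * D.d₁ c.R * hr
  have h9 : IsUnit (9 * v₂) := by
    have : (9 : 𝒪) = 3 * 3 := by norm_num
    rw [this]
    exact (h3.mul h3).mul h.isUnit
  refine h9.mul_left_cancel ?_
  rw [key, hc.S_eq]
  subst hpd hqd hrd
  simp only [B, map_add, map_sub, Derivation.map_mul_eq, Derivation.map_pow_eq,
    Derivation.map_ofNat_eq_zero, Derivation.map_natCast, map_zero, h.d₁_v₂, h.d₂_v₂, h.d₂_v₁, h.d₂_l₁, D.comm, E.comm,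
    h.d₁_eq c'.Q, h.d₁_eq c'.R, h.d₁_eq c'.S,
    h.d₂_eq c'.P, h.d₂_eq c'.Q, h.d₂_eq c'.R, h.d₂_eq c'.S,
    h.d₁_eq (E.d₁ c'.S),
    h.d₁_eq (E.d₂ c'.R), h.d₁_eq (E.d₂ c'.S),
    h.d₂_eq (E.d₂ c'.Q), h.d₂_eq (E.d₂ c'.R), h.d₂_eq (E.d₂ c'.S)]
  push_cast
  ring

end Frame

namespace Frame

variable {𝒪 : Type*} [CommRing 𝒪]
variable {D E : Frame 𝒪} {v₁ v₂ l₁ l₂ : 𝒪} {c c' : Coeffs 𝒪}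

/-- The functions `φ₁`, `φ₂` are those for which the symmetrized covariant derivative of the
field `α` vanishes. -/
structure IsGauge (D : Frame 𝒪) (c : Coeffs 𝒪) (φ₁ φ₂ : 𝒪) : Prop where
  eq₁₁ : 5 * D.A c * φ₁ = -3 * (D.B c * c.P + D.d₁ (D.A c)) + 3 * c.Q * D.A c
  eq₁₂ : 5 * (D.A c * φ₂ + D.B c * φ₁)
    = -3 * (D.d₁ (D.B c) + D.d₂ (D.A c)) - 6 * D.B c * c.Q + 6 * D.A c * c.R
  eq₂₂ : 5 * D.B c * φ₂ = 3 * (D.A c * c.S - D.d₂ (D.B c)) - 3 * c.R * D.B c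

theorem isGauge_swap_iff {φ₁ φ₂ : 𝒪} : IsGauge D.swap c.swap φ₂ φ₁ ↔ IsGauge D c φ₁ φ₂ := by
  have e : ∀ f, D.swap.d₁ f = D.d₂ f := fun _ => rfl
  have e' : ∀ f, D.swap.d₂ f = D.d₁ f := fun _ => rfl
  have eP : c.swap.P = -c.S := rfl
  have eQ : c.swap.Q = -c.R := rfl
  have eR : c.swap.R = -c.Q := rfl
  have eS : c.swap.S = -c.P := rfl
  constructor <;> rintro ⟨h1, h2, h3⟩
  · simp only [A_swap, B_swap, e, e', map_neg, eP, eQ, eR, eS] at h1 h2 h3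
    exact ⟨by linear_combination -h3, by linear_combination -h2, by linear_combination -h1⟩
  · constructor
    all_goals simp only [A_swap, B_swap, e, e', map_neg, eP, eQ, eR, eS]
    exacts [by linear_combination -h3, by linear_combination -h2, by linear_combination -h1]

/-- The three equations are the components 11, 12, 22 of a symmetric tensor, hence the quadratic
combinations in v₁, v₂. The shift by −l₁, −l₂ is −d log v₂, and v₂ is the Jacobian. -/
theorem FiberChange.isGauge (h : FiberChange D E v₁ v₂ l₁ l₂) (hc : FiberLaw D v₁ v₂ l₁ l₂ c c')
    (h3 : IsUnit (3 : 𝒪)) {φ₁ φ₂ : 𝒪} (hφ : IsGauge E c' φ₁ φ₂) :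
    IsGauge D c (φ₁ + v₁ * φ₂ - l₁) (v₂ * φ₂ - l₂) := by
  obtain ⟨h11, h12, h22⟩ := hφ
  have hP := hc.P_eq
  have hQ := hc.Q_eq
  have hR := hc.R_eq
  constructor
  all_goals
    simp only [h.A_eq hc h3, h.B_eq hc h3, map_add, Derivation.map_mul_eq, Derivation.map_pow_eq,
      h.d₁_v₂, h.d₂_v₂, h.d₂_v₁, h.d₁_eq (E.A c'), h.d₁_eq (E.B c'), h.d₂_eq (E.A c'),
      h.d₂_eq (E.B c')]
    push_cast
  · linear_combination v₂ * (h11 + v₁ * h12 + v₁ ^ 2 * h22) + 3 * v₂ * E.B c' * hP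
      - v₂ * (E.A c' + v₁ * E.B c') * hQ
  · linear_combination v₂ ^ 2 * (h12 + 2 * v₁ * h22) + 2 * v₂ ^ 2 * E.B c' * hQ
      - 2 * v₂ * (E.A c' + v₁ * E.B c') * hR
  · linear_combination v₂ ^ 3 * h22 - 3 * v₂ * (E.A c' + v₁ * E.B c') * hc.S_eq
      + v₂ ^ 2 * E.B c' * hR

theorem FiberChange.of_coord {v w : 𝒪} (h₁ : ∀ f, D.d₁ f = E.d₁ f + D.d₁ v * E.d₂ f)
    (h₂ : ∀ f, D.d₂ f = D.d₂ v * E.d₂ f) (hw : w * D.d₂ v = 1) :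
    FiberChange D E (D.d₁ v) (D.d₂ v) (w * D.d₁ (D.d₂ v)) (w * D.d₂ (D.d₂ v)) where
  d₁_eq := h₁
  d₂_eq := h₂
  isUnit := IsUnit.of_mul_eq_one_right w hw
  d₂_v₁ := by rw [D.comm]; linear_combination -D.d₁ (D.d₂ v) * hw
  d₁_v₂ := by linear_combination -D.d₁ (D.d₂ v) * hw
  d₂_v₂ := by linear_combination -D.d₂ (D.d₂ v) * hw
  d₂_l₁ := by
    simp only [Derivation.map_mul_eq, D.d₁.leibniz_of_mul_eq_one hw,
      D.d₂.leibniz_of_mul_eq_one hw, D.comm, smul_eq_mul]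
    ring

/-! ### General changes of coordinates -/

/-- The frames `D` and `E` belong to coordinates `(x, y)` and `(X, Y)`, and `δ` is the inverse of
the Jacobian determinant. -/
structure CoordChange (D E : Frame 𝒪) (X Y δ : 𝒪) : Prop where
  d₁_eq : ∀ f, D.d₁ f = D.d₁ X * E.d₁ f + D.d₁ Y * E.d₂ f
  d₂_eq : ∀ f, D.d₂ f = D.d₂ X * E.d₁ f + D.d₂ Y * E.d₂ f
  inv : δ * (D.d₁ X * D.d₂ Y - D.d₂ X * D.d₁ Y) = 1

/-- The Jacobian determinant of `(X, Y)`. -/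
def jac (D : Frame 𝒪) (X Y : 𝒪) : 𝒪 := D.d₁ X * D.d₂ Y - D.d₂ X * D.d₁ Y

/-- The transformation law of the coefficients under a change of coordinates. -/
structure CoeffLaw (D : Frame 𝒪) (X Y : 𝒪) (c c' : Coeffs 𝒪) : Prop where
  eq₀ : D.jac X Y * c.P + D.d₁ X * D.d₁ (D.d₁ Y) - D.d₁ Y * D.d₁ (D.d₁ X)
    = c'.P * D.d₁ X ^ 3 + 3 * c'.Q * D.d₁ X ^ 2 * D.d₁ Y + 3 * c'.R * D.d₁ X * D.d₁ Y ^ 2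
      + c'.S * D.d₁ Y ^ 3
  eq₁ : 3 * D.jac X Y * c.Q + D.d₂ X * D.d₁ (D.d₁ Y) + 2 * D.d₁ X * D.d₁ (D.d₂ Y)
      - D.d₂ Y * D.d₁ (D.d₁ X) - 2 * D.d₁ Y * D.d₁ (D.d₂ X)
    = 3 * c'.P * D.d₁ X ^ 2 * D.d₂ X
      + 3 * c'.Q * (2 * D.d₁ X * D.d₂ X * D.d₁ Y + D.d₁ X ^ 2 * D.d₂ Y)
      + 3 * c'.R * (D.d₂ X * D.d₁ Y ^ 2 + 2 * D.d₁ X * D.d₁ Y * D.d₂ Y)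
      + 3 * c'.S * D.d₁ Y ^ 2 * D.d₂ Y
  eq₂ : 3 * D.jac X Y * c.R + D.d₁ X * D.d₂ (D.d₂ Y) + 2 * D.d₂ X * D.d₁ (D.d₂ Y)
      - D.d₁ Y * D.d₂ (D.d₂ X) - 2 * D.d₂ Y * D.d₁ (D.d₂ X)
    = 3 * c'.P * D.d₁ X * D.d₂ X ^ 2
      + 3 * c'.Q * (2 * D.d₁ X * D.d₂ X * D.d₂ Y + D.d₂ X ^ 2 * D.d₁ Y)
      + 3 * c'.R * (D.d₁ X * D.d₂ Y ^ 2 + 2 * D.d₂ X * D.d₁ Y * D.d₂ Y)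
      + 3 * c'.S * D.d₁ Y * D.d₂ Y ^ 2
  eq₃ : D.jac X Y * c.S + D.d₂ X * D.d₂ (D.d₂ Y) - D.d₂ Y * D.d₂ (D.d₂ X)
    = c'.P * D.d₂ X ^ 3 + 3 * c'.Q * D.d₂ X ^ 2 * D.d₂ Y + 3 * c'.R * D.d₂ X * D.d₂ Y ^ 2
      + c'.S * D.d₂ Y ^ 3

/-- The transformation laws of the field `α` and of the functions `φ₁`, `φ₂`. -/
structure Covariant (D E : Frame 𝒪) (X Y δ : 𝒪) (c c' : Coeffs 𝒪) : Prop where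
  A_eq : D.A c = D.jac X Y * (D.d₁ X * E.A c' + D.d₁ Y * E.B c')
  B_eq : D.B c = D.jac X Y * (D.d₂ X * E.A c' + D.d₂ Y * E.B c')
  isGauge : ∀ φ₁ φ₂, IsGauge E c' φ₁ φ₂ →
    IsGauge D c (D.d₁ X * φ₁ + D.d₁ Y * φ₂ - δ * D.d₁ (D.jac X Y))
      (D.d₂ X * φ₁ + D.d₂ Y * φ₂ - δ * D.d₂ (D.jac X Y))

/-- The frame of the coordinates `(X, y)`, `u` being the inverse of `X_x`. -/
def partialFrame (D : Frame 𝒪) (X u : 𝒪) (hu : u * D.d₁ X = 1) : Frame 𝒪 where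
  d₁ := u • D.d₁
  d₂ := D.d₂ - (D.d₂ X * u) • D.d₁
  comm f := by
    simp only [Derivation.sub_apply, Derivation.smul_apply, smul_eq_mul, Derivation.map_mul_eq,
      map_sub, D.d₁.leibniz_of_mul_eq_one hu, D.d₂.leibniz_of_mul_eq_one hu, D.comm]
    ring

variable {X Y δ : 𝒪}

/-- If X_x is invertible, the change factors as (x, y) ↦ (X, y) ↦ (X, Y), each step altering one
coordinate; the laws for fiber changes are then composed. -/
theorem CoordChange.covariant_of_isUnit (h : CoordChange D E X Y δ) (hc : CoeffLaw D X Y c c')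
    (h3 : IsUnit (3 : 𝒪)) (hX : IsUnit (D.d₁ X)) : Covariant D E X Y δ c c' := by
  obtain ⟨u, hu'⟩ := hX.exists_left_inv
  have hu : D.d₁ X * u = 1 := by rw [mul_comm]; exact hu'
  obtain ⟨r, hr⟩ := h3.exists_left_inv
  have hδ := h.inv
  set F := D.partialFrame X u hu' with hF
  have F₁ : ∀ f, F.d₁ f = u * D.d₁ f := fun f => rfl
  have F₂ : ∀ f, F.d₂ f = D.d₂ f - D.d₂ X * u * D.d₁ f := fun f => rfl
  have hw : D.d₁ X * δ * F.d₂ Y = 1 := by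
    rw [F₂]; linear_combination hδ - δ * D.d₂ X * D.d₁ Y * hu
  have hFE := FiberChange.of_coord (D := F) (E := E) (v := Y) (w := D.d₁ X * δ)
    (fun f => by simp only [F₁]; rw [h.d₁_eq f]; linear_combination E.d₁ f * hu)
    (fun f => by
      simp only [F₂]; rw [h.d₁_eq f, h.d₂_eq f]; linear_combination - D.d₂ X * E.d₁ f * hu) hw
  -- Here y stays and x changes, so this is a fiber change only after exchanging the coordinates.
  have hDF := FiberChange.of_coord (D := D.swap) (E := F.swap) (v := X) (w := u)
    (fun f => by
      change D.d₂ f = F.d₂ f + D.d₂ X * F.d₁ f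
      rw [F₁, F₂]; ring)
    (fun f => by
      change D.d₁ f = D.d₁ X * F.d₁ f
      rw [F₁]; linear_combination -D.d₁ f * hu) hu'
  set a := F.d₁ Y with ha
  set g := F.d₂ Y with hg
  set w := D.d₁ X * δ with hw_def
  set l₁ := w * F.d₁ g with hl₁
  set l₂ := w * F.d₂ g with hl₂
  -- The coefficients in the intermediate coordinates (X, y), found by solving `FiberLaw`: `w`
  -- inverts g, the derivative of Y by y at fixed X, and `r` inverts 3.
  let b : Coeffs 𝒪 :=
    { P := w * (c'.P + 3 * c'.Q * a + 3 * c'.R * a ^ 2 + c'.S * a ^ 3 - F.d₁ a)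
      Q := r * (3 * c'.Q + 6 * c'.R * a + 3 * c'.S * a ^ 2 - 2 * l₁)
      R := r * (3 * c'.R * g + 3 * c'.S * a * g - l₂)
      S := c'.S * g ^ 2 }
  have hbc : FiberLaw F a g l₁ l₂ b c' := by
    constructor <;> simp only [b]
    · linear_combination (c'.P + 3 * c'.Q * a + 3 * c'.R * a ^ 2 + c'.S * a ^ 3 - F.d₁ a) * hw
    · linear_combination (3 * c'.Q + 6 * c'.R * a + 3 * c'.S * a ^ 2 - 2 * l₁) * hr
    · linear_combination (3 * c'.R * g + 3 * c'.S * a * g - l₂) * hr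
  have hY₁ : D.d₁ Y = D.d₁ X * a := by rw [ha, F₁]; linear_combination -D.d₁ Y * hu
  have hY₂ : D.d₂ Y = g + D.d₂ X * a := by rw [hg, ha, F₁, F₂]; ring
  have hY₁₁ : D.d₁ (D.d₁ Y) = D.d₁ X * D.d₁ a + a * D.d₁ (D.d₁ X) := by
    rw [hY₁, Derivation.map_mul_eq]
  have hY₁₂ : D.d₁ (D.d₂ Y) = D.d₁ X * D.d₂ a + a * D.d₁ (D.d₂ X) := by
    rw [← D.comm, hY₁, Derivation.map_mul_eq, D.comm]
  have hY₁₂' : D.d₁ (D.d₂ Y) = D.d₁ g + D.d₂ X * D.d₁ a + a * D.d₁ (D.d₂ X) := by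
    rw [hY₂, map_add, Derivation.map_mul_eq]; ring
  have hY₂₂ : D.d₂ (D.d₂ Y) = D.d₂ g + D.d₂ X * D.d₂ a + a * D.d₂ (D.d₂ X) := by
    rw [hY₂, map_add, Derivation.map_mul_eq]; ring
  have hJ : D.jac X Y = D.d₁ X * g := by rw [jac, hY₁, hY₂]; ring
  have hg_unit : IsUnit (D.d₁ X * g) := by
    rw [← hJ]; exact IsUnit.of_mul_eq_one_right δ hδ
  have e₁ : D.d₁ X * g * l₁ = D.d₁ g := by
    rw [hl₁, F₁]; linear_combination D.d₁ X * u * D.d₁ g * hw + D.d₁ g * hu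
  have e₂ : D.d₁ X * g * l₂ = D.d₁ X * D.d₂ g - D.d₂ X * D.d₁ g := by
    rw [hl₂, F₂]
    linear_combination D.d₁ X * (D.d₂ g - D.d₂ X * u * D.d₁ g) * hw - D.d₂ X * D.d₁ g * hu
  have eP : D.d₁ X * g * b.P
      = D.d₁ X * (c'.P + 3 * c'.Q * a + 3 * c'.R * a ^ 2 + c'.S * a ^ 3) - D.d₁ a := by
    have := hbc.P_eq
    rw [F₁] at this
    linear_combination D.d₁ X * this - D.d₁ a * hu
  have eQ := hbc.Q_eq
  have eR := hbc.R_eq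
  have eS := hbc.S_eq
  have hcb : FiberLaw D.swap (D.d₂ X) (D.d₁ X) (u * D.d₂ (D.d₁ X)) (u * D.d₁ (D.d₁ X))
      c.swap b.swap := by
    obtain ⟨h₀, h₁, h₂, h₃⟩ := hc
    rw [hJ, hY₁₁, hY₁] at h₀
    rw [hJ, hY₁₁, hY₁₂, hY₁, hY₂] at h₁
    rw [hJ, hY₂₂, hY₁₂, hY₁, hY₂] at h₂
    rw [hJ, hY₂₂, hY₂] at h₃
    -- Two expressions for Y_xy give the integrability relation X_x a_y = g_x + X_y a_x.
    have h12 := hY₁₂.symm.trans hY₁₂'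
    constructor
    · refine hg_unit.mul_left_cancel ?_
      change D.d₁ X * g * (D.d₁ X * -c.S) = D.d₁ X * g * (-b.S + 3 * -b.R * D.d₂ X
        + 3 * -b.Q * D.d₂ X ^ 2 + -b.P * D.d₂ X ^ 3 - D.d₂ (D.d₂ X))
      linear_combination -D.d₁ X * h₃ + D.d₁ X * g * eS + D.d₁ X * g * D.d₂ X * eR
        + D.d₁ X * g * D.d₂ X ^ 2 * eQ + D.d₂ X ^ 3 * eP - D.d₂ X * e₂
        - 2 * D.d₂ X ^ 2 * e₁ + D.d₂ X ^ 2 * h12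
    · refine hg_unit.mul_left_cancel ?_
      change D.d₁ X * g * (3 * -c.R) = D.d₁ X * g * (3 * -b.R
        + 6 * -b.Q * D.d₂ X + 3 * -b.P * D.d₂ X ^ 2 - 2 * (u * D.d₂ (D.d₁ X)))
      rw [D.comm]
      linear_combination -h₂ + D.d₁ X * g * eR + 2 * D.d₁ X * g * D.d₂ X * eQ
        + 3 * D.d₂ X ^ 2 * eP - e₂ - 4 * D.d₂ X * e₁ + 3 * D.d₂ X * h12
        + 2 * g * D.d₁ (D.d₂ X) * hu
    · refine hg_unit.mul_left_cancel ?_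
      change D.d₁ X * g * (3 * -c.Q) = D.d₁ X * g * (3 * -b.Q * D.d₁ X
        + 3 * -b.P * D.d₂ X * D.d₁ X - u * D.d₁ (D.d₁ X))
      linear_combination -h₁ + D.d₁ X ^ 2 * g * eQ + 3 * D.d₁ X * D.d₂ X * eP
        - 2 * D.d₁ X * e₁ + 2 * D.d₁ X * h12 + g * D.d₁ (D.d₁ X) * hu
    · refine hg_unit.mul_left_cancel ?_
      change D.d₁ X * g * (-c.P) = D.d₁ X * g * (-b.P * D.d₁ X ^ 2)
      linear_combination -h₀ + D.d₁ X ^ 2 * eP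
  have hA := hDF.A_eq hcb h3
  have hB := hDF.B_eq hcb h3
  rw [A_swap, A_swap, B_swap, hFE.A_eq hbc h3, hFE.B_eq hbc h3] at hA
  rw [B_swap, B_swap, hFE.A_eq hbc h3] at hB
  change -D.B c = D.d₁ X * (_ + D.d₂ X * _) at hA
  change -D.A c = D.d₁ X ^ 2 * _ at hB
  refine ⟨?_, ?_, fun φ₁ φ₂ hφ => ?_⟩
  · rw [hJ, hY₁]; linear_combination -hB
  · rw [hJ, hY₂]; linear_combination -hA
  · have h1 := hFE.isGauge hbc h3 hφ
    have h2 := hDF.isGauge hcb h3 (isGauge_swap_iff.2 h1)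
    rw [isGauge_swap_iff] at h2
    have hw' : δ * (D.d₁ X * g) = 1 := by linear_combination hw
    convert h2 using 1
    · change _ = D.d₁ X * (φ₁ + a * φ₂ - l₁) - u * D.d₁ (D.d₁ X)
      rw [hJ, hY₁, Derivation.map_mul_eq, hl₁, F₁]
      linear_combination (D.d₁ X * δ * D.d₁ g + δ * g * D.d₁ (D.d₁ X)) * hu
        - u * D.d₁ (D.d₁ X) * hw'
    · change _ = g * φ₂ - l₂ + D.d₂ X * (φ₁ + a * φ₂ - l₁) - u * D.d₂ (D.d₁ X)
      rw [hJ, hY₂, Derivation.map_mul_eq, hl₁, hl₂, F₁, F₂]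
      linear_combination δ * g * D.d₂ (D.d₁ X) * hu - u * D.d₂ (D.d₁ X) * hw'
end Frame

namespace Frame

variable {𝒪 : Type*} [CommRing 𝒪]
variable {D E : Frame 𝒪} {c c' : Coeffs 𝒪} {X Y δ : 𝒪}

theorem jac_swap : D.swap.jac X Y = -D.jac X Y := by
  change D.d₂ X * D.d₁ Y - D.d₁ X * D.d₂ Y = _
  rw [jac]; ring

theorem CoordChange.swap (h : CoordChange D E X Y δ) : CoordChange D.swap E X Y (-δ) where
  d₁_eq := h.d₂_eq
  d₂_eq := h.d₁_eq
  inv := by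
    change -δ * (D.d₂ X * D.d₁ Y - D.d₁ X * D.d₂ Y) = 1
    linear_combination h.inv

theorem CoeffLaw.swap (h : CoeffLaw D X Y c c') : CoeffLaw D.swap X Y c.swap c' := by
  have e : ∀ f, D.swap.d₁ f = D.d₂ f := fun _ => rfl
  have e' : ∀ f, D.swap.d₂ f = D.d₁ f := fun _ => rfl
  have eP : c.swap.P = -c.S := rfl
  have eQ : c.swap.Q = -c.R := rfl
  have eR : c.swap.R = -c.Q := rfl
  have eS : c.swap.S = -c.P := rfl
  obtain ⟨h₀, h₁, h₂, h₃⟩ := h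
  constructor
  all_goals simp only [jac_swap, e, e', eP, eQ, eR, eS, D.comm]
  exacts [by linear_combination h₃, by linear_combination h₂, by linear_combination h₁,
    by linear_combination h₀]

theorem Covariant.of_swap (h : Covariant D.swap E X Y (-δ) c.swap c') :
    Covariant D E X Y δ c c' := by
  have e : ∀ f, D.swap.d₁ f = D.d₂ f := fun _ => rfl
  have e' : ∀ f, D.swap.d₂ f = D.d₁ f := fun _ => rfl
  obtain ⟨hA, hB, hφ⟩ := h
  rw [A_swap, jac_swap, e, e] at hA
  rw [B_swap, jac_swap, e', e'] at hB
  refine ⟨by linear_combination -hB, by linear_combination -hA, fun φ₁ φ₂ h => ?_⟩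
  have := hφ φ₁ φ₂ h
  simp only [jac_swap, e, e', map_neg, neg_mul_neg] at this
  exact isGauge_swap_iff.1 this

/-- If X_y rather than X_x is invertible, exchanging x and y reduces to the case already treated. -/
theorem CoordChange.covariant (h : CoordChange D E X Y δ) (hc : CoeffLaw D X Y c c')
    (h3 : IsUnit (3 : 𝒪)) (hX : IsUnit (D.d₁ X) ∨ IsUnit (D.d₂ X)) :
    Covariant D E X Y δ c c' := by
  rcases hX with hX | hX
  · exact h.covariant_of_isUnit hc h3 hX
  · exact (h.swap.covariant_of_isUnit hc.swap h3 hX).of_swap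

/-- The frame of the coordinates `(X, Y)`, where `δ` is the inverse of the Jacobian determinant. -/
def coordFrame (D : Frame 𝒪) (X Y δ : 𝒪)
    (hδ : δ * (D.d₁ X * D.d₂ Y - D.d₂ X * D.d₁ Y) = 1) : Frame 𝒪 where
  d₁ := (δ * D.d₂ Y) • D.d₁ - (δ * D.d₁ Y) • D.d₂
  d₂ := (δ * D.d₁ X) • D.d₂ - (δ * D.d₂ X) • D.d₁
  comm f := by
    simp only [Derivation.sub_apply, Derivation.smul_apply, smul_eq_mul, Derivation.map_mul_eq,
      map_sub, D.d₁.leibniz_of_mul_eq_one hδ, D.d₂.leibniz_of_mul_eq_one hδ, D.comm]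
    linear_combination -(δ ^ 2 * ((D.d₁ X * D.d₂ (D.d₂ Y) + D.d₂ Y * D.d₁ (D.d₂ X)
      - D.d₂ X * D.d₁ (D.d₂ Y) - D.d₁ Y * D.d₂ (D.d₂ X)) * D.d₁ f
      - (D.d₁ X * D.d₁ (D.d₂ Y) + D.d₂ Y * D.d₁ (D.d₁ X)
      - D.d₂ X * D.d₁ (D.d₁ Y) - D.d₁ Y * D.d₁ (D.d₂ X)) * D.d₂ f)) * hδ

section CoordFrame

variable (hδ : δ * (D.d₁ X * D.d₂ Y - D.d₂ X * D.d₁ Y) = 1)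

theorem coordFrame_d₁ (f : 𝒪) :
    (D.coordFrame X Y δ hδ).d₁ f = δ * D.d₂ Y * D.d₁ f - δ * D.d₁ Y * D.d₂ f := rfl

theorem coordFrame_d₂ (f : 𝒪) :
    (D.coordFrame X Y δ hδ).d₂ f = δ * D.d₁ X * D.d₂ f - δ * D.d₂ X * D.d₁ f := rfl

theorem coordChange_coordFrame : CoordChange D (D.coordFrame X Y δ hδ) X Y δ where
  d₁_eq f := by rw [coordFrame_d₁, coordFrame_d₂]; linear_combination -D.d₁ f * hδ
  d₂_eq f := by rw [coordFrame_d₁, coordFrame_d₂]; linear_combination -D.d₂ f * hδ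
  inv := hδ

theorem coordFrame_d₁_left : (D.coordFrame X Y δ hδ).d₁ X = 1 := by
  rw [coordFrame_d₁]; linear_combination hδ

theorem coordFrame_d₁_right : (D.coordFrame X Y δ hδ).d₁ Y = 0 := by
  rw [coordFrame_d₁]; ring

theorem coordFrame_d₂_left : (D.coordFrame X Y δ hδ).d₂ X = 0 := by
  rw [coordFrame_d₂]; ring

theorem coordFrame_d₂_right : (D.coordFrame X Y δ hδ).d₂ Y = 1 := by
  rw [coordFrame_d₂]; linear_combination hδ

end CoordFrame

/-! ### Weighted fields and their transformation laws -/

/-- First component of the field `β`. -/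
def G (D : Frame 𝒪) (c : Coeffs 𝒪) : 𝒪 :=
  -D.B c * D.d₁ (D.B c) - 3 * D.A c * D.d₂ (D.B c) + 4 * D.B c * D.d₂ (D.A c)
    + 3 * c.S * D.A c ^ 2 - 6 * c.R * D.B c * D.A c + 3 * c.Q * D.B c ^ 2

/-- Second component of the field `β`. -/
def H (D : Frame 𝒪) (c : Coeffs 𝒪) : 𝒪 :=
  -D.A c * D.d₂ (D.A c) - 3 * D.B c * D.d₁ (D.A c) + 4 * D.A c * D.d₁ (D.B c)
    - 3 * c.P * D.B c ^ 2 + 6 * c.Q * D.A c * D.B c - 3 * c.R * D.A c ^ 2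

/-- The covariant curl of the field `α`. -/
def curl (D : Frame 𝒪) (c : Coeffs 𝒪) (φ₁ φ₂ : 𝒪) : 𝒪 :=
  D.d₁ (D.B c) - D.d₂ (D.A c) + φ₁ * D.B c - φ₂ * D.A c

/-- Three linear equations in two unknowns: eliminating φ₁ and φ₂ leaves exactly 3F⁵ = 0. -/
theorem IsGauge.A_mul_G_add {φ₁ φ₂ : 𝒪} (h : IsGauge D c φ₁ φ₂) :
    D.A c * D.G c + D.B c * D.H c = 0 := by
  obtain ⟨h₁, h₂, h₃⟩ := h
  rw [G, H]
  linear_combination -D.A c ^ 2 * h₃ + D.A c * D.B c * h₂ - D.B c ^ 2 * h₁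

/-- Together with `IsGauge.B_mul_curl` this shows that −5/6 of the curl is N on either patch, so N
can be handled without choosing one. -/
theorem IsGauge.A_mul_curl {φ₁ φ₂ : 𝒪} (h : IsGauge D c φ₁ φ₂) :
    5 * D.A c * D.curl c φ₁ φ₂ = 2 * D.H c := by
  obtain ⟨h₁, h₂, -⟩ := h
  rw [curl, H]
  linear_combination 2 * D.B c * h₁ - D.A c * h₂

theorem IsGauge.B_mul_curl {φ₁ φ₂ : 𝒪} (h : IsGauge D c φ₁ φ₂) :
    5 * D.B c * D.curl c φ₁ φ₂ = -2 * D.G c := by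
  obtain ⟨-, h₂, h₃⟩ := h
  rw [curl, G]
  linear_combination D.B c * h₂ - 2 * D.A c * h₃

/-- First component of the covariant differential of a field of weight `m`. -/
def cov₁ (D : Frame 𝒪) (φ : 𝒪) (m : ℕ) (f : 𝒪) : 𝒪 := D.d₁ f + m * φ * f

/-- Second component of the covariant differential of a field of weight `m`. -/
def cov₂ (D : Frame 𝒪) (φ : 𝒪) (m : ℕ) (f : 𝒪) : 𝒪 := D.d₂ f + m * φ * f

/-- The field `M` of weight 4 that belongs to a field `n` of weight 2. -/
def M (D : Frame 𝒪) (c : Coeffs 𝒪) (φ₁ φ₂ n : 𝒪) : 𝒪 :=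
  D.B c * D.cov₁ φ₁ 2 n - D.A c * D.cov₂ φ₂ 2 n

/-- The field `Z` of weight 7 that belongs to a field `n` of weight 2 and a field `m` of
weight 4. -/
def Z (D : Frame 𝒪) (φ₁ φ₂ n m : 𝒪) : 𝒪 :=
  D.cov₁ φ₁ 4 m * D.cov₂ φ₂ 2 n - D.cov₂ φ₂ 4 m * D.cov₁ φ₁ 2 n

/-- The functions `φ₁`, `φ₂` and `φ₁'`, `φ₂'` correspond under a change of coordinates. -/
structure GaugeLaw (D : Frame 𝒪) (X Y δ φ₁ φ₂ φ₁' φ₂' : 𝒪) : Prop where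
  eq₁ : φ₁ = D.d₁ X * φ₁' + D.d₁ Y * φ₂' - δ * D.d₁ (D.jac X Y)
  eq₂ : φ₂ = D.d₂ X * φ₁' + D.d₂ Y * φ₂' - δ * D.d₂ (D.jac X Y)

variable {φ₁ φ₂ φ₁' φ₂' : 𝒪}

/-- The product rule on J^m f produces m J^(m−1) dJ f, which the term −d log J in φ cancels. -/
theorem CoordChange.cov₁_eq (h : CoordChange D E X Y δ) (hφ : GaugeLaw D X Y δ φ₁ φ₂ φ₁' φ₂')
    (m : ℕ) (f : 𝒪) : D.cov₁ φ₁ m (D.jac X Y ^ m * f)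
      = D.jac X Y ^ m * (D.d₁ X * E.cov₁ φ₁' m f + D.d₁ Y * E.cov₂ φ₂' m f) := by
  have hδ : δ * D.jac X Y = 1 := h.inv
  simp only [cov₁, cov₂, hφ.eq₁, Derivation.map_mul_eq, Derivation.map_pow_eq, h.d₁_eq f]
  -- Weight 0 is separate because of the truncated exponent m − 1 in the power rule.
  rcases m with _ | m
  · simp
  · rw [Nat.add_sub_cancel]
    linear_combination -(((m + 1 : ℕ) : 𝒪) * f * D.jac X Y ^ m * D.d₁ (D.jac X Y)) * hδ

theorem CoordChange.cov₂_eq (h : CoordChange D E X Y δ) (hφ : GaugeLaw D X Y δ φ₁ φ₂ φ₁' φ₂')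
    (m : ℕ) (f : 𝒪) : D.cov₂ φ₂ m (D.jac X Y ^ m * f)
      = D.jac X Y ^ m * (D.d₂ X * E.cov₁ φ₁' m f + D.d₂ Y * E.cov₂ φ₂' m f) := by
  have hδ : δ * D.jac X Y = 1 := h.inv
  simp only [cov₁, cov₂, hφ.eq₂, Derivation.map_mul_eq, Derivation.map_pow_eq, h.d₂_eq f]
  rcases m with _ | m
  · simp
  · rw [Nat.add_sub_cancel]
    linear_combination -(((m + 1 : ℕ) : 𝒪) * f * D.jac X Y ^ m * D.d₂ (D.jac X Y)) * hδ

theorem CoordChange.curl_eq (h : CoordChange D E X Y δ) (hc : Covariant D E X Y δ c c')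
    (hφ : GaugeLaw D X Y δ φ₁ φ₂ φ₁' φ₂') :
    D.curl c φ₁ φ₂ = D.jac X Y ^ 2 * E.curl c' φ₁' φ₂' := by
  have hδ : δ * D.jac X Y = 1 := h.inv
  have hJ : D.jac X Y = D.d₁ X * D.d₂ Y - D.d₂ X * D.d₁ Y := rfl
  simp only [curl, hc.A_eq, hc.B_eq, hφ.eq₁, hφ.eq₂, Derivation.map_mul_eq, map_add,
    h.d₁_eq (E.A c'), h.d₁_eq (E.B c'), h.d₂_eq (E.A c'), h.d₂_eq (E.B c'), D.comm]
  generalize D.d₁ (D.jac X Y) = j₁ at *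
  generalize D.d₂ (D.jac X Y) = j₂ at *
  generalize D.jac X Y = j at *
  linear_combination (j₂ * (D.d₁ X * E.A c' + D.d₁ Y * E.B c')
    - j₁ * (D.d₂ X * E.A c' + D.d₂ Y * E.B c')) * hδ
    - j * (E.d₁ (E.B c') - E.d₂ (E.A c') + φ₁' * E.B c' - φ₂' * E.A c') * hJ

/-- The weight is 1 from α, 2 from n and 1 from the determinant of two covectors; for Z it is 4 + 2
+ 1 in the same way. -/
theorem CoordChange.M_eq (h : CoordChange D E X Y δ) (hc : Covariant D E X Y δ c c')
    (hφ : GaugeLaw D X Y δ φ₁ φ₂ φ₁' φ₂') (n : 𝒪) :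
    D.M c φ₁ φ₂ (D.jac X Y ^ 2 * n) = D.jac X Y ^ 4 * E.M c' φ₁' φ₂' n := by
  simp only [M, h.cov₁_eq hφ, h.cov₂_eq hφ, hc.A_eq, hc.B_eq]
  rw [jac]; ring

theorem CoordChange.Z_eq (h : CoordChange D E X Y δ)
    (hφ : GaugeLaw D X Y δ φ₁ φ₂ φ₁' φ₂') (n m : 𝒪) :
    D.Z φ₁ φ₂ (D.jac X Y ^ 2 * n) (D.jac X Y ^ 4 * m)
      = D.jac X Y ^ 7 * E.Z φ₁' φ₂' n m := by
  simp only [Z, h.cov₁_eq hφ, h.cov₂_eq hφ]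
  rw [jac]; ring

/-- The inhomogeneous term d log J is closed, so the curl of φ is a plain density. -/
theorem CoordChange.omega_eq (h : CoordChange D E X Y δ)
    (hφ : GaugeLaw D X Y δ φ₁ φ₂ φ₁' φ₂') :
    D.d₂ φ₁ - D.d₁ φ₂ = D.jac X Y * (E.d₂ φ₁' - E.d₁ φ₂') := by
  have hδ : δ * D.jac X Y = 1 := h.inv
  have hJ : D.jac X Y = D.d₁ X * D.d₂ Y - D.d₂ X * D.d₁ Y := rfl
  simp only [hφ.eq₁, hφ.eq₂, Derivation.map_mul_eq, map_add, map_sub, D.comm,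
    D.d₁.leibniz_of_mul_eq_one hδ, D.d₂.leibniz_of_mul_eq_one hδ, smul_eq_mul,
    h.d₁_eq φ₁', h.d₁_eq φ₂', h.d₂_eq φ₁', h.d₂_eq φ₂']
  linear_combination -(E.d₂ φ₁' - E.d₁ φ₂') * hJ

theorem CoordChange.along_eq (h : CoordChange D E X Y δ) (hc : Covariant D E X Y δ c c') (f : 𝒪) :
    D.B c * D.d₁ f - D.A c * D.d₂ f
      = D.jac X Y ^ 2 * (E.B c' * E.d₁ f - E.A c' * E.d₂ f) := by
  rw [hc.A_eq, hc.B_eq, h.d₁_eq f, h.d₂_eq f, jac]; ring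

end Frame

namespace Frame

variable {𝒪 : Type*} [CommRing 𝒪]

/-! ### The fields of the fourth Painlevé equation -/

/-- The coefficients `c` are those of the fourth Painlevé equation in the coordinates `X`, `Y` of
the frame `E`; `W` is the inverse of `Y`. -/
structure IsPainleveIV (E : Frame 𝒪) (c : Coeffs 𝒪) (X Y W a b : 𝒪) : Prop where
  d₁_X : E.d₁ X = 1
  d₂_X : E.d₂ X = 0
  d₁_Y : E.d₁ Y = 0
  d₂_Y : E.d₂ Y = 1
  d₁_a : E.d₁ a = 0
  d₂_a : E.d₂ a = 0
  d₁_b : E.d₁ b = 0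
  d₂_b : E.d₂ b = 0
  inv : Y * W = 1
  P_eq : 2 * c.P = 3 * Y ^ 3 + 8 * X * Y ^ 2 + 4 * (X ^ 2 - a) * Y + 2 * b * W
  Q_eq : c.Q = 0
  R_eq : 6 * c.R = W
  S_eq : c.S = 0

namespace IsPainleveIV

variable {E : Frame 𝒪} {c : Coeffs 𝒪} {X Y W a b : 𝒪}

theorem d₁_W (h : IsPainleveIV E c X Y W a b) : E.d₁ W = 0 := by
  rw [E.d₁.leibniz_of_mul_eq_one (mul_comm Y W ▸ h.inv), h.d₁_Y, smul_zero]

theorem d₂_W (h : IsPainleveIV E c X Y W a b) : E.d₂ W = -W ^ 2 := by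
  rw [E.d₂.leibniz_of_mul_eq_one (mul_comm Y W ▸ h.inv), h.d₂_Y, smul_eq_mul, mul_one]

theorem d₁_R (h : IsPainleveIV E c X Y W a b) (h6 : IsUnit (6 : 𝒪)) : E.d₁ c.R = 0 := by
  refine h6.mul_left_cancel ?_
  have := congrArg E.d₁ h.R_eq
  rw [Derivation.map_mul_eq, Derivation.map_ofNat_eq_zero, h.d₁_W] at this
  linear_combination this

theorem d₂_R (h : IsPainleveIV E c X Y W a b) : 6 * E.d₂ c.R = -W ^ 2 := by
  have := congrArg E.d₂ h.R_eq
  rw [Derivation.map_mul_eq, Derivation.map_ofNat_eq_zero, h.d₂_W] at this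
  linear_combination this

theorem B_eq (h : IsPainleveIV E c X Y W a b) (h6 : IsUnit (6 : 𝒪)) : E.B c = 0 := by
  rw [B, ← E.comm]
  simp [h.d₁_R h6, h.Q_eq, h.S_eq]

/-- The part 2(X² − a)Y of P contributes nothing: its second Y-derivative is zero, and since R =
1/(6Y) the terms −3PR_Y and −3RP_Y cancel on it. This is why a disappears. -/
theorem A_eq (h : IsPainleveIV E c X Y W a b) (h6 : IsUnit (6 : 𝒪)) :
    2 * E.A c = 15 * Y + 12 * X + 6 * b * W ^ 3 := by
  have hP := h.P_eq
  have hP2 := congrArg E.d₂ hP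
  have hP22 := congrArg E.d₂ hP2
  simp only [map_add, map_sub, map_neg, map_zero, Derivation.map_mul_eq, Derivation.map_pow_eq,
    Derivation.map_ofNat_eq_zero, Derivation.map_natCast, h.d₂_X, h.d₂_Y, h.d₂_a, h.d₂_b,
    h.d₂_W, Derivation.map_one_eq_zero] at hP2 hP22
  push_cast at hP2 hP22
  simp only [A, h.d₁_R h6, h.Q_eq, h.S_eq, map_zero]
  have hYW := h.inv
  have hR := h.R_eq
  have hR2 := h.d₂_R
  refine h6.mul_left_cancel ?_
  linear_combination 6 * hP22 - 6 * c.P * hR2 - 6 * E.d₂ c.P * hR + 3 * W ^ 2 * hP - 3 * W * hP2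
    + ((9 * Y + 24 * X) * (Y * W + 1) + 12 * (X ^ 2 - a) * W - 27 * Y - 48 * X) * hYW

theorem d₁_A (h : IsPainleveIV E c X Y W a b) (h6 : IsUnit (6 : 𝒪)) : E.d₁ (E.A c) = 6 := by
  have h2 : IsUnit (2 : 𝒪) := isUnit_of_dvd_unit ⟨3, by norm_num⟩ h6
  have := congrArg E.d₁ (h.A_eq h6)
  simp only [map_add, Derivation.map_mul_eq, Derivation.map_pow_eq, h.d₁_X, h.d₁_Y, h.d₁_b,
    h.d₁_W, Derivation.map_ofNat_eq_zero] at this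
  exact h2.mul_left_cancel (by linear_combination this)

theorem d₂_A (h : IsPainleveIV E c X Y W a b) (h6 : IsUnit (6 : 𝒪)) :
    2 * E.d₂ (E.A c) = 15 - 18 * b * W ^ 4 := by
  have := congrArg E.d₂ (h.A_eq h6)
  simp only [map_add, Derivation.map_mul_eq, Derivation.map_pow_eq, h.d₂_X, h.d₂_Y, h.d₂_b,
    h.d₂_W, Derivation.map_ofNat_eq_zero] at this
  push_cast at this
  linear_combination this

/-- As B = S = 0, the third gauge equation reads 0 = 0, and the other two are solved by dividing by
5A. -/
theorem exists_isGauge (h : IsPainleveIV E c X Y W a b) (h6 : IsUnit (6 : 𝒪))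
    (h5 : IsUnit (5 : 𝒪)) (hA : IsUnit (E.A c)) : ∃ φ₁ φ₂, IsGauge E c φ₁ φ₂ := by
  obtain ⟨r, hr⟩ := (h5.mul hA).exists_right_inv
  refine ⟨r * (-3 * E.d₁ (E.A c)), r * (-3 * E.d₂ (E.A c) + 6 * E.A c * c.R), ?_, ?_, ?_⟩
  all_goals rw [h.B_eq h6]; simp only [h.Q_eq, h.S_eq, map_zero]
  · linear_combination -3 * E.d₁ (E.A c) * hr
  · linear_combination (-3 * E.d₂ (E.A c) + 6 * E.A c * c.R) * hr
  · ring

variable {φ₁ φ₂ : 𝒪}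

theorem A_mul_φ₁ (h : IsPainleveIV E c X Y W a b) (h6 : IsUnit (6 : 𝒪))
    (hφ : IsGauge E c φ₁ φ₂) : 5 * E.A c * φ₁ = -18 := by
  have := hφ.eq₁₁
  rw [h.B_eq h6, h.Q_eq, h.d₁_A h6] at this
  linear_combination this

theorem A_mul_φ₂ (h : IsPainleveIV E c X Y W a b) (h6 : IsUnit (6 : 𝒪))
    (hφ : IsGauge E c φ₁ φ₂) : 5 * E.A c * φ₂ = -3 * E.d₂ (E.A c) + E.A c * W := by
  have := hφ.eq₁₂
  rw [h.B_eq h6, h.Q_eq, map_zero] at this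
  linear_combination this + E.A c * h.R_eq

/-- The covector φ is −(3/5) d log A + (1/5) W dY with W a function of Y alone, hence closed. -/
theorem omega_eq (h : IsPainleveIV E c X Y W a b) (h6 : IsUnit (6 : 𝒪))
    (h5 : IsUnit (5 : 𝒪)) (hA : IsUnit (E.A c)) (hφ : IsGauge E c φ₁ φ₂) :
    E.d₂ φ₁ - E.d₁ φ₂ = 0 := by
  have e₁ := h.A_mul_φ₁ h6 hφ
  have e₂ := h.A_mul_φ₂ h6 hφ
  have e₁' := congrArg E.d₂ e₁
  have e₂' := congrArg E.d₁ e₂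
  simp only [map_add, map_neg, Derivation.map_mul_eq, Derivation.map_ofNat_eq_zero, h.d₁_W,
    ← E.comm, h.d₁_A h6] at e₁' e₂'
  refine ((h5.mul hA).mul hA).mul_left_cancel ?_
  linear_combination E.A c * e₁' - E.A c * e₂' - E.d₂ (E.A c) * e₁ + 6 * e₂

/-- The field `N` of the fourth Painlevé equation. -/
theorem N_eq (h : IsPainleveIV E c X Y W a b) (h6 : IsUnit (6 : 𝒪)) (hφ : IsGauge E c φ₁ φ₂)
    {n : 𝒪} (hn : 6 * n = -5 * E.curl c φ₁ φ₂) :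
    4 * n = 15 + 4 * (X * W) - 10 * (b * W ^ 4) := by
  have h3 : IsUnit (3 : 𝒪) := isUnit_of_dvd_unit ⟨2, by norm_num⟩ h6
  have e₂ := h.A_mul_φ₂ h6 hφ
  have hA := h.A_eq h6
  have hA2 := h.d₂_A h6
  rw [curl, h.B_eq h6, map_zero] at hn
  refine h3.mul_left_cancel ?_
  linear_combination 2 * hn + 2 * e₂ + 2 * hA2 + W * hA + 15 * h.inv

/-- The field `M` of the fourth Painlevé equation. -/
theorem M_eq (h : IsPainleveIV E c X Y W a b) (h6 : IsUnit (6 : 𝒪)) (hφ : IsGauge E c φ₁ φ₂)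
    {n : 𝒪} (hn : 6 * n = -5 * E.curl c φ₁ φ₂) :
    10 * E.M c φ₁ φ₂ n = 36 * (X * W) ^ 2 + 45 * (X * W) - 630 * (X * W) * (b * W ^ 4) + 225
      - 1350 * (b * W ^ 4) := by
  have h2 : IsUnit (2 : 𝒪) := isUnit_of_dvd_unit ⟨3, by norm_num⟩ h6
  have e₂ := h.A_mul_φ₂ h6 hφ
  have hA := h.A_eq h6
  have hA2 := h.d₂_A h6
  have hN := h.N_eq h6 hφ hn
  have hN2 := congrArg E.d₂ hN
  simp only [map_add, map_sub, Derivation.map_mul_eq, Derivation.map_pow_eq, h.d₂_X, h.d₂_b,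
    h.d₂_W, Derivation.map_ofNat_eq_zero] at hN2
  push_cast at hN2
  rw [M, h.B_eq h6, cov₂]
  push_cast
  refine (h2.mul h2).mul_left_cancel ?_
  linear_combination -10 * E.A c * hN2 - 5 * (-4 * X * W ^ 2 + 40 * b * W ^ 5) * hA - 16 * n * e₂
    + 24 * n * hA2 - 8 * n * W * hA
    + (6 * (15 - 18 * b * W ^ 4) - 2 * W * (15 * Y + 12 * X + 6 * b * W ^ 3)) * hN
    - (75 * (-4 * X * W + 40 * b * W ^ 4) + 30 * (15 + 4 * X * W - 10 * b * W ^ 4)) * h.inv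

theorem A_mul_W (h : IsPainleveIV E c X Y W a b) (h6 : IsUnit (6 : 𝒪)) :
    2 * E.A c * W = 15 + 12 * (X * W) + 6 * (b * W ^ 4) := by
  linear_combination W * h.A_eq h6 + 15 * h.inv

/-- With `A_mul_d₂_s`: 2A ∂/∂Y is −g times the Euler operator giving t weight 1 and s weight 4,
where g = 2AW. -/
theorem A_mul_d₂_t (h : IsPainleveIV E c X Y W a b) (h6 : IsUnit (6 : 𝒪)) :
    2 * E.A c * E.d₂ (X * W) = -(15 + 12 * (X * W) + 6 * (b * W ^ 4)) * (X * W) := by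
  rw [Derivation.map_mul_eq, h.d₂_X, h.d₂_W]
  linear_combination -X * W * h.A_mul_W h6

theorem A_mul_d₂_s (h : IsPainleveIV E c X Y W a b) (h6 : IsUnit (6 : 𝒪)) :
    2 * E.A c * E.d₂ (b * W ^ 4)
      = -4 * (15 + 12 * (X * W) + 6 * (b * W ^ 4)) * (b * W ^ 4) := by
  rw [Derivation.map_mul_eq, Derivation.map_pow_eq, h.d₂_b, h.d₂_W]
  push_cast
  linear_combination -4 * b * W ^ 4 * h.A_mul_W h6

theorem d₁_t (h : IsPainleveIV E c X Y W a b) : E.d₁ (X * W) = W := by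
  rw [Derivation.map_mul_eq, h.d₁_X, h.d₁_W]; ring

theorem d₁_s (h : IsPainleveIV E c X Y W a b) : E.d₁ (b * W ^ 4) = 0 := by
  rw [Derivation.map_mul_eq, Derivation.map_pow_eq, h.d₁_b, h.d₁_W]; ring

/-- The field `Z` of the fourth Painlevé equation. -/
theorem Z_eq (h : IsPainleveIV E c X Y W a b) (h6 : IsUnit (6 : 𝒪)) (h5 : IsUnit (5 : 𝒪))
    (hφ : IsGauge E c φ₁ φ₂) {n : 𝒪} (hn : 6 * n = -5 * E.curl c φ₁ φ₂) :
    200 * E.A c ^ 2 * E.Z φ₁ φ₂ n (E.M c φ₁ φ₂ n)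
      = -129600 * (X * W) ^ 3 - 162000 * (X * W) ^ 2 + 6674400 * (X * W) ^ 2 * (b * W ^ 4)
        + 202500 * (X * W) + 17010000 * (X * W) * (b * W ^ 4)
        + 6771600 * (X * W) * (b * W ^ 4) ^ 2 + 253125 + 10833750 * (b * W ^ 4)
        + 8545500 * (b * W ^ 4) ^ 2 + 1701000 * (b * W ^ 4) ^ 3 := by
  have e₁ := h.A_mul_φ₁ h6 hφ
  have e₂ := h.A_mul_φ₂ h6 hφ
  have hA2 := h.d₂_A h6
  have hN := h.N_eq h6 hφ hn
  have hM := h.M_eq h6 hφ hn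
  have hMd : E.M c φ₁ φ₂ n = -E.A c * E.cov₂ φ₂ 2 n := by rw [M, h.B_eq h6]; ring
  have hN1 := congrArg E.d₁ hN
  have hM1 := congrArg E.d₁ hM
  have hM2 := congrArg E.d₂ hM
  have hg := h.A_mul_W h6
  have ht := h.A_mul_d₂_t h6
  have hs := h.A_mul_d₂_s h6
  generalize ht' : X * W = t at *
  generalize hs' : b * W ^ 4 = s at *
  generalize E.M c φ₁ φ₂ n = m at *
  have ht1 : E.d₁ t = W := by rw [← ht']; exact h.d₁_t
  have hs1 : E.d₁ s = 0 := by rw [← hs']; exact h.d₁_s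
  simp only [map_add, map_sub, Derivation.map_mul_eq, Derivation.map_pow_eq, ht1, hs1,
    Derivation.map_ofNat_eq_zero] at hN1 hM1 hM2
  push_cast at hM1 hM2
  -- The factor 5A turns φ₁, φ₂ into known values; after inserting `hN` and `hM` all four covariant
  -- derivatives are polynomials in t and s.
  have n₁ : 2 * (5 * E.A c * E.cov₁ φ₁ 2 n) = 5 * (15 + 12 * t + 6 * s) - 18 * (4 * n) := by
    have h4 : IsUnit (2 : 𝒪) := isUnit_of_dvd_unit ⟨3, by norm_num⟩ h6
    refine (h4.mul h4).mul_left_cancel ?_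
    rw [cov₁]; push_cast
    linear_combination 10 * E.A c * hN1 + 16 * n * e₁ + 20 * hg
  have n₂ : 2 * (5 * E.A c * E.cov₂ φ₂ 2 n) = -(10 * m) := by linear_combination 10 * hMd
  have m₁ : 20 * (5 * E.A c * E.cov₁ φ₁ 4 m)
      = 5 * (15 + 12 * t + 6 * s) * (72 * t + 45 - 630 * s) - 144 * (10 * m) := by
    rw [cov₁]; push_cast
    linear_combination 10 * E.A c * hM1 + 80 * m * e₁ + 5 * (72 * t + 45 - 630 * s) * hg
  have m₂ : 20 * (5 * E.A c * E.cov₂ φ₂ 4 m)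
      = -5 * (15 + 12 * t + 6 * s) * (72 * t ^ 2 + 45 * t - 3150 * t * s - 5400 * s)
        + 4 * (10 * m) * (12 * t + 60 * s - 30) := by
    rw [cov₂]; push_cast
    linear_combination 10 * E.A c * hM2 + 80 * m * e₂ + 5 * (72 * t + 45 - 630 * s) * ht
      + 5 * (-630 * t - 1350) * hs - 120 * m * hA2 + 40 * m * hg + 2160 * m * hs'
  rw [hN] at n₁
  rw [hM] at n₂ m₁ m₂
  refine h5.mul_left_cancel ?_
  rw [Z]
  linear_combination (20 * (5 * E.A c * E.cov₁ φ₁ 4 m)) * n₂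
    - (36 * t ^ 2 + 45 * t - 630 * t * s + 225 - 1350 * s) * m₁
    - (20 * (5 * E.A c * E.cov₂ φ₂ 4 m)) * n₁
    - (5 * (15 + 12 * t + 6 * s) - 18 * (15 + 4 * t - 10 * s)) * m₂

/-- The derivatives along `α` of the first invariant of the fourth Painlevé equation. -/
theorem invariants_eq (h : IsPainleveIV E c X Y W a b) (h6 : IsUnit (6 : 𝒪))
    (hφ : IsGauge E c φ₁ φ₂) {n : 𝒪}
    (hn : 6 * n = -5 * E.curl c φ₁ φ₂) {i₁ i₄ i₁₀ : 𝒪}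
    (hi₁ : i₁ * n ^ 2 = E.M c φ₁ φ₂ n) (hi₄ : i₄ * n = -E.A c * E.d₂ i₁)
    (hi₁₀ : i₁₀ * n = -E.A c * E.d₂ i₄) {t s σ μ σ₁ μ₁ σ₂ μ₂ g g₁ U V U₁ V₁ : 𝒪}
    (ht : t = X * W) (hs : s = b * W ^ 4)
    (hσ : σ = 15 + 4 * t - 10 * s)
    (hμ : μ = 36 * t ^ 2 + 45 * t - 630 * t * s + 225 - 1350 * s)
    (hg : g = 15 + 12 * t + 6 * s)
    (hσ₁ : σ₁ = 4 * t - 40 * s) (hμ₁ : μ₁ = 72 * t ^ 2 + 45 * t - 3150 * t * s - 5400 * s)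
    (hg₁ : g₁ = 12 * t + 24 * s)
    (hσ₂ : σ₂ = 4 * t - 160 * s)
    (hμ₂ : μ₂ = 144 * t ^ 2 + 45 * t - 15750 * t * s - 21600 * s)
    (hU : U = μ₁ * σ - 2 * σ₁ * μ) (hV : V = g * U)
    (hU₁ : U₁ = μ₂ * σ - μ₁ * σ₁ - 2 * σ₂ * μ) (hV₁ : V₁ = g₁ * U + g * U₁) :
    4 * n = σ ∧ 10 * E.M c φ₁ φ₂ n = μ ∧ 5 * i₁ * σ ^ 2 = 8 * μ ∧ 5 * i₄ * σ ^ 4 = 16 * V ∧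
      5 * i₁₀ * σ ^ 6 = 32 * (g * (V₁ * σ - 4 * σ₁ * V)) := by
  have hN : 4 * n = σ := by rw [h.N_eq h6 hφ hn, hσ, ht, hs]
  have hM : 10 * E.M c φ₁ φ₂ n = μ := by rw [h.M_eq h6 hφ hn, hμ, ht, hs]
  have h2 : IsUnit (2 : 𝒪) := isUnit_of_dvd_unit ⟨3, by norm_num⟩ h6
  -- Let θ = t∂_t + 4s∂_s, so 2A ∂/∂Y = −gθ. Indices 1 and 2 count applications of θ, U is σ³
  -- θ(μ/σ²), and each further invariant is 2g/σ times θ of the previous one.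
  have dt : 2 * E.A c * E.d₂ t = -g * t := by rw [hg, ht, hs]; exact h.A_mul_d₂_t h6
  have ds : 2 * E.A c * E.d₂ s = -4 * g * s := by rw [hg, ht, hs]; exact h.A_mul_d₂_s h6
  have dσ : 2 * E.A c * E.d₂ σ = -g * σ₁ := by
    rw [hσ, hσ₁]
    simp only [map_add, map_sub, Derivation.map_mul_eq, Derivation.map_ofNat_eq_zero]
    linear_combination 4 * dt - 10 * ds
  have dμ : 2 * E.A c * E.d₂ μ = -g * μ₁ := by
    rw [hμ, hμ₁]
    simp only [map_add, map_sub, Derivation.map_mul_eq, Derivation.map_pow_eq,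
      Derivation.map_ofNat_eq_zero]
    push_cast
    linear_combination (72 * t + 45 - 630 * s) * dt + (-630 * t - 1350) * ds
  have dσ₁ : 2 * E.A c * E.d₂ σ₁ = -g * σ₂ := by
    rw [hσ₁, hσ₂]
    simp only [map_sub, Derivation.map_mul_eq, Derivation.map_ofNat_eq_zero]
    linear_combination 4 * dt - 40 * ds
  have dμ₁ : 2 * E.A c * E.d₂ μ₁ = -g * μ₂ := by
    rw [hμ₁, hμ₂]
    simp only [map_add, map_sub, Derivation.map_mul_eq, Derivation.map_pow_eq,
      Derivation.map_ofNat_eq_zero]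
    push_cast
    linear_combination (144 * t + 45 - 3150 * s) * dt + (-3150 * t - 5400) * ds
  have dg : 2 * E.A c * E.d₂ g = -g * g₁ := by
    nth_rw 1 [hg]
    rw [hg₁]
    simp only [map_add, Derivation.map_mul_eq, Derivation.map_ofNat_eq_zero]
    linear_combination 12 * dt + 6 * ds
  have dU : 2 * E.A c * E.d₂ U = -g * U₁ := by
    rw [hU, hU₁]
    simp only [map_sub, Derivation.map_mul_eq, Derivation.map_ofNat_eq_zero]
    linear_combination σ * dμ₁ + μ₁ * dσ - 2 * μ * dσ₁ - 2 * σ₁ * dμ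
  have dV : 2 * E.A c * E.d₂ V = -g * V₁ := by
    rw [hV, hV₁, Derivation.map_mul_eq]
    linear_combination U * dg + g * dU
  have r₁ : 5 * i₁ * σ ^ 2 = 8 * μ := by
    refine h2.mul_left_cancel ?_
    rw [← hN, ← hM]; linear_combination 160 * hi₁
  have r₄ : 5 * i₄ * σ ^ 4 = 16 * V := by
    have d := congrArg E.d₂ r₁
    simp only [Derivation.map_mul_eq, Derivation.map_pow_eq, Derivation.map_ofNat_eq_zero] at d
    push_cast at d
    rw [hV, hU]
    linear_combination -5 * i₄ * σ ^ 3 * hN + 20 * σ ^ 3 * hi₄ - 4 * σ * E.A c * d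
      - 16 * σ * dμ + 20 * i₁ * σ ^ 2 * dσ - 4 * g * σ₁ * r₁
  have r₁₀ : 5 * i₁₀ * σ ^ 6 = 32 * (g * (V₁ * σ - 4 * σ₁ * V)) := by
    have d := congrArg E.d₂ r₄
    simp only [Derivation.map_mul_eq, Derivation.map_pow_eq, Derivation.map_ofNat_eq_zero] at d
    push_cast at d
    linear_combination -5 * i₁₀ * σ ^ 5 * hN + 20 * σ ^ 5 * hi₁₀ - 4 * σ * E.A c * d
      - 32 * σ * dV + 40 * i₄ * σ ^ 4 * dσ - 8 * g * σ₁ * r₄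
  exact ⟨hN, hM, r₁, r₄, r₁₀⟩

end IsPainleveIV
end Frame

/-! ### Elimination of the parameters t and s -/

/-- The invariants of the fourth Painlevé equation with `b = 0` as functions of `t = x / y`. -/
theorem K₀_eq_zero_of_param {K : Type*} [RCLike K] {t σ μ σ₁ μ₁ g J₁ J₄ : K}
    (hσ : σ = 15 + 4 * t) (hμ : μ = 36 * t ^ 2 + 45 * t + 225) (hg : g = 15 + 12 * t)
    (hσ₁ : σ₁ = 4 * t) (hμ₁ : μ₁ = 72 * t ^ 2 + 45 * t) (h0 : σ ≠ 0)
    (h1 : 9 * J₁ * σ ^ 2 = μ) (h4 : 675 * J₄ * σ ^ 4 = g * (μ₁ * σ - 2 * σ₁ * μ)) :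
    K₀ J₁ J₄ = 0 := by
  have e1 : J₁ = μ / (9 * σ ^ 2) := by rw [eq_div_iff (by simpa using h0)]; linear_combination h1
  have e4 : J₄ = g * (μ₁ * σ - 2 * σ₁ * μ) / (675 * σ ^ 4) := by
    rw [eq_div_iff (by simpa using h0)]; linear_combination h4
  -- With σ as parameter the denominators are powers of a single variable, and the claim becomes a
  -- polynomial identity in σ.
  have ht : t = (σ - 15) / 4 := by rw [hσ]; ring
  rw [K₀, e1, e4]
  field_simp
  rw [hσ₁, hμ₁, hμ, hg, ht]
  ring

/-- The invariants of the fourth Painlevé equation as functions of `t = x / y` and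
`s = b / y ^ 4`. -/
theorem Kₙ_eq_zero_of_param {K : Type*} [RCLike K]
    {t s σ μ σ₁ μ₁ σ₂ μ₂ g g₁ U V U₁ V₁ J₁ J₄ J₁₀ : K}
    (hσ : σ = 15 + 4 * t - 10 * s)
    (hμ : μ = 36 * t ^ 2 + 45 * t - 630 * t * s + 225 - 1350 * s)
    (hg : g = 15 + 12 * t + 6 * s)
    (hσ₁ : σ₁ = 4 * t - 40 * s) (hμ₁ : μ₁ = 72 * t ^ 2 + 45 * t - 3150 * t * s - 5400 * s)
    (hg₁ : g₁ = 12 * t + 24 * s)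
    (hσ₂ : σ₂ = 4 * t - 160 * s)
    (hμ₂ : μ₂ = 144 * t ^ 2 + 45 * t - 15750 * t * s - 21600 * s)
    (hU : U = μ₁ * σ - 2 * σ₁ * μ) (hV : V = g * U)
    (hU₁ : U₁ = μ₂ * σ - μ₁ * σ₁ - 2 * σ₂ * μ) (hV₁ : V₁ = g₁ * U + g * U₁)
    (h0 : σ ≠ 0)
    (h1 : 9 * J₁ * σ ^ 2 = μ) (h4 : 675 * J₄ * σ ^ 4 = V)
    (h10 : 2025 * J₁₀ * σ ^ 6 = g * (V₁ * σ - 4 * σ₁ * V)) :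
    Kₙ J₁ J₄ J₁₀ = 0 := by
  have e1 : J₁ = μ / (9 * σ ^ 2) := by rw [eq_div_iff (by simpa using h0)]; linear_combination h1
  have e4 : J₄ = V / (675 * σ ^ 4) := by
    rw [eq_div_iff (by simpa using h0)]; linear_combination h4
  have e10 : J₁₀ = g * (V₁ * σ - 4 * σ₁ * V) / (2025 * σ ^ 6) := by
    rw [eq_div_iff (by simpa using h0)]; linear_combination h10
  -- With σ and s as parameters only powers of σ are denominators. The numerators are expanded in
  -- advance so that the final identity is between polynomials in σ and s.
  have ht : t = (σ - 15 + 10 * s) / 4 := by rw [hσ]; ring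
  have fμ : μ = 9 / 4 * σ ^ 2 - 225 / 2 * σ * s - 225 / 4 * σ - 1350 * s ^ 2 + 450 * s + 1125 / 2 := by
    rw [hμ, ht]; ring
  have fV : V = -2025 / 2 * σ ^ 3 * s + 675 / 4 * σ ^ 3 - 46575 * σ ^ 2 * s ^ 2 + 4725 * σ ^ 2 * s -
        30375 / 4 * σ ^ 2 - 656100 * σ * s ^ 3 + 214650 * σ * s ^ 2 + 145125 * σ * s + 219375 /
        2 * σ - 2916000 * s ^ 4 + 1944000 * s ^ 3 + 2106000 * s ^ 2 - 810000 * s - 506250 := by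
    rw [hV, hU, hμ, hg, hσ₁, hμ₁, ht]; ring
  have fW : g * (V₁ * σ - 4 * σ₁ * V) = -18225 / 2 * σ ^ 5 * s - 2025 / 4 * σ ^ 5 - 1038825 * σ ^ 4 * s ^ 2 + 83025 * σ ^ 4 * s
        + 232875 / 4 * σ ^ 4 - 37251900 * σ ^ 3 * s ^ 3 + 9148950 * σ ^ 3 * s ^ 2 + 151875 * σ ^
        3 * s - 4404375 / 2 * σ ^ 3 - 595301400 * σ ^ 2 * s ^ 4 + 275562000 * σ ^ 2 * s ^ 3 +
        88573500 * σ ^ 2 * s ^ 2 + 34222500 * σ ^ 2 * s + 75178125 / 2 * σ ^ 2 - 4435236000 * σ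
        * s ^ 5 + 3188646000 * σ * s ^ 4 + 2068902000 * σ * s ^ 3 - 256365000 * σ * s ^ 2 -
        569531250 * σ * s - 299953125 * σ - 12597120000 * s ^ 6 + 12597120000 * s ^ 5 +
        11547360000 * s ^ 4 - 10031040000 * s ^ 3 - 4811400000 * s ^ 2 + 2187000000 * s +
        911250000 := by
    rw [hV₁, hU₁, fV, hU, hμ, hg, hσ₁, hμ₁, hσ₂, hμ₂, hg₁, ht]; ring
  generalize g * (V₁ * σ - 4 * σ₁ * V) = W at *
  clear h1 h4 h10 hV hU hV₁ hU₁
  rw [Kₙ, e1, e4, e10]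
  field_simp
  rw [fμ, fV, fW]
  ring

/-! ### From jets to the transformation law of the coefficients -/

section PointTransformation

variable {𝕜 : Type*} [RCLike 𝕜]

/-- Multiplying the cubic by α + βp removes the excluded slope, and a nonzero linear factor can then
be cancelled. -/
theorem cubic_coeff_eq_zero {α β c₀ c₁ c₂ c₃ : 𝕜} (hαβ : α ≠ 0 ∨ β ≠ 0)
    (h : ∀ p, α + β * p ≠ 0 → c₀ + c₁ * p + c₂ * p ^ 2 + c₃ * p ^ 3 = 0) :
    c₀ = 0 ∧ c₁ = 0 ∧ c₂ = 0 ∧ c₃ = 0 := by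
  have h' : ∀ p, (α + β * p) * (c₀ + c₁ * p + c₂ * p ^ 2 + c₃ * p ^ 3) = 0 := fun p => by
    by_cases hp : α + β * p = 0
    · rw [hp, zero_mul]
    · rw [h p hp, mul_zero]
  have e₀ := h' 0
  have e₁ := h' 1
  have e₂ := h' (-1)
  have e₃ := h' 2
  have e₄ := h' (-2)
  -- Finite differences at 0, ±1, ±2 isolate the five coefficients of the quartic.
  have k₀ : α * c₀ = 0 := by linear_combination e₀
  have k₄ : β * c₃ = 0 := by
    linear_combination (e₃ + e₄ - 4 * e₁ - 4 * e₂ + 6 * e₀) / 24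
  have k₂ : α * c₂ + β * c₁ = 0 := by linear_combination (e₁ + e₂) / 2 - e₀ - k₄
  have k₃ : α * c₃ + β * c₂ = 0 := by linear_combination (e₃ - e₄ - 2 * e₁ + 2 * e₂) / 12
  have k₁ : α * c₁ + β * c₀ = 0 := by linear_combination (e₁ - e₂) / 2 - k₃
  rcases hαβ with hα | hβ
  · have c₀0 : c₀ = 0 := (mul_eq_zero.1 k₀).resolve_left hα
    rw [c₀0, mul_zero, add_zero] at k₁
    have c₁0 : c₁ = 0 := (mul_eq_zero.1 k₁).resolve_left hα
    rw [c₁0, mul_zero, add_zero] at k₂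
    have c₂0 : c₂ = 0 := (mul_eq_zero.1 k₂).resolve_left hα
    rw [c₂0, mul_zero, add_zero] at k₃
    exact ⟨c₀0, c₁0, c₂0, (mul_eq_zero.1 k₃).resolve_left hα⟩
  · have c₃0 : c₃ = 0 := (mul_eq_zero.1 k₄).resolve_left hβ
    rw [c₃0, mul_zero, zero_add] at k₃
    have c₂0 : c₂ = 0 := (mul_eq_zero.1 k₃).resolve_left hβ
    rw [c₂0, mul_zero, zero_add] at k₂
    have c₁0 : c₁ = 0 := (mul_eq_zero.1 k₂).resolve_left hβ
    rw [c₁0, mul_zero, zero_add] at k₁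
    exact ⟨(mul_eq_zero.1 k₁).resolve_left hβ, c₁0, c₂0, c₃0⟩

variable {E E' : CubicODE 𝕜} {T : OpenPartialHomeomorph (𝕜 × 𝕜) (𝕜 × 𝕜)} {z : 𝕜 × 𝕜}

namespace CubicODE.TransformsInto

theorem contDiffAt (h : E.TransformsInto E' T) (hz : z ∈ T.source) : ContDiffAt 𝕜 ∞ T z :=
  h.2.2.1.contDiffAt (T.open_source.mem_nhds hz)

theorem jac_ne_zero (h : E.TransformsInto E' T) (hz : z ∈ T.source) :
    dx (fun w => (T w).1) z * dy (fun w => (T w).2) z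
      - dy (fun w => (T w).1) z * dx (fun w => (T w).2) z ≠ 0 := by
  intro h0
  have hT : DifferentiableAt 𝕜 T z := (h.contDiffAt hz).differentiableAt (by simp)
  have hS : DifferentiableAt 𝕜 T.symm (T z) :=
    (h.2.2.2.1.contDiffAt (T.open_target.mem_nhds (T.map_source hz))).differentiableAt (by simp)
  have hc : (fderiv 𝕜 T.symm (T z)).comp (fderiv 𝕜 T z) = ContinuousLinearMap.id 𝕜 (𝕜 × 𝕜) := by
    rw [← fderiv_comp z hS hT, ← fderiv_id (x := z)]
    refine EventuallyEq.fderiv_eq ?_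
    filter_upwards [T.open_source.mem_nhds hz] with w hw using T.left_inv hw
  have hinj : ∀ v, fderiv 𝕜 T z v = 0 → v = 0 := fun v hv => by
    have := congrArg (fun L => L v) hc
    simpa [hv] using this.symm
  have e₁ : ∀ v, (fderiv 𝕜 T z v).1 = fderiv 𝕜 (fun w => (T w).1) z v := fun v => by
    rw [fderiv.fst hT]; rfl
  have e₂ : ∀ v, (fderiv 𝕜 T z v).2 = fderiv 𝕜 (fun w => (T w).2) z v := fun v => by
    rw [fderiv.snd hT]; rfl
  have lin : ∀ (f : 𝕜 × 𝕜 → 𝕜) (p q : 𝕜), fderiv 𝕜 f z (p, q) = p * dx f z + q * dy f z := by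
    intro f p q
    have : ((p, q) : 𝕜 × 𝕜) = p • (1, 0) + q • (0, 1) := by simp
    rw [this, map_add, map_smul, map_smul, smul_eq_mul, smul_eq_mul, dx, dy]
  have hker : ∀ p q, p * dx (fun w => (T w).1) z + q * dy (fun w => (T w).1) z = 0 →
      p * dx (fun w => (T w).2) z + q * dy (fun w => (T w).2) z = 0 → p = 0 ∧ q = 0 := by
    intro p q hp hq
    have := hinj (p, q) (Prod.ext (by rw [e₁, lin]; exact hp) (by rw [e₂, lin]; exact hq))
    exact ⟨congrArg Prod.fst this, congrArg Prod.snd this⟩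
  -- If J = 0, then (X_y, −X_x) and (Y_y, −Y_x) lie in the kernel of the injective differential; so
  -- all first derivatives vanish, and (1, 0) is in the kernel too.
  have k₁ := hker (dy (fun w => (T w).1) z) (-dx (fun w => (T w).1) z) (by ring)
    (by linear_combination -h0)
  have k₂ := hker (dy (fun w => (T w).2) z) (-dx (fun w => (T w).2) z)
    (by linear_combination h0) (by ring)
  exact one_ne_zero (hker 1 0 (by linear_combination -k₁.2) (by linear_combination -k₂.2)).1

/-- For y'' given by `E`, clearing powers of X_x + X_y p leaves a cubic identity in the slope p,
whose coefficients are compared. -/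
theorem coeff_eq (h : E.TransformsInto E' T) (hz : z ∈ T.source) {X₁ X₂ Y₁ Y₂ X₁₁ X₁₂ X₂₂ Y₁₁ Y₁₂
    Y₂₂ : 𝕜} (hX₁ : X₁ = dx (fun w => (T w).1) z) (hX₂ : X₂ = dy (fun w => (T w).1) z)
    (hY₁ : Y₁ = dx (fun w => (T w).2) z) (hY₂ : Y₂ = dy (fun w => (T w).2) z)
    (hX₁₁ : X₁₁ = dx (dx fun w => (T w).1) z) (hX₁₂ : X₁₂ = dx (dy fun w => (T w).1) z)
    (hX₂₂ : X₂₂ = dy (dy fun w => (T w).1) z) (hY₁₁ : Y₁₁ = dx (dx fun w => (T w).2) z)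
    (hY₁₂ : Y₁₂ = dx (dy fun w => (T w).2) z) (hY₂₂ : Y₂₂ = dy (dy fun w => (T w).2) z) :
    (X₁ * Y₂ - X₂ * Y₁) * E.P z + X₁ * Y₁₁ - Y₁ * X₁₁
      = E'.P (T z) * X₁ ^ 3 + 3 * E'.Q (T z) * X₁ ^ 2 * Y₁ + 3 * E'.R (T z) * X₁ * Y₁ ^ 2
        + E'.S (T z) * Y₁ ^ 3 ∧
    3 * (X₁ * Y₂ - X₂ * Y₁) * E.Q z + X₂ * Y₁₁ + 2 * X₁ * Y₁₂ - Y₂ * X₁₁ - 2 * Y₁ * X₁₂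
      = 3 * E'.P (T z) * X₁ ^ 2 * X₂ + 3 * E'.Q (T z) * (2 * X₁ * X₂ * Y₁ + X₁ ^ 2 * Y₂)
        + 3 * E'.R (T z) * (X₂ * Y₁ ^ 2 + 2 * X₁ * Y₁ * Y₂) + 3 * E'.S (T z) * Y₁ ^ 2 * Y₂ ∧
    3 * (X₁ * Y₂ - X₂ * Y₁) * E.R z + X₁ * Y₂₂ + 2 * X₂ * Y₁₂ - Y₁ * X₂₂ - 2 * Y₂ * X₁₂
      = 3 * E'.P (T z) * X₁ * X₂ ^ 2 + 3 * E'.Q (T z) * (2 * X₁ * X₂ * Y₂ + X₂ ^ 2 * Y₁)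
        + 3 * E'.R (T z) * (X₁ * Y₂ ^ 2 + 2 * X₂ * Y₁ * Y₂) + 3 * E'.S (T z) * Y₁ * Y₂ ^ 2 ∧
    (X₁ * Y₂ - X₂ * Y₁) * E.S z + X₂ * Y₂₂ - Y₂ * X₂₂
      = E'.P (T z) * X₂ ^ 3 + 3 * E'.Q (T z) * X₂ ^ 2 * Y₂ + 3 * E'.R (T z) * X₂ * Y₂ ^ 2
        + E'.S (T z) * Y₂ ^ 3 := by
  have hj := h.jac_ne_zero hz
  rw [← hX₁, ← hX₂, ← hY₁, ← hY₂] at hj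
  have hX : X₁ ≠ 0 ∨ X₂ ≠ 0 := by
    by_contra! h0
    exact hj (by rw [h0.1, h0.2]; ring)
  have key := fun p (hp : X₁ + X₂ * p ≠ 0) =>
    (h.2.2.2.2 z hz p (E.rhs z p) (by rw [totalDeriv, ← hX₁, ← hX₂]; exact hp)).1 rfl
  simp only [newSecond, newSlope, totalDeriv, totalDeriv₂, CubicODE.rhs, ← hX₁, ← hX₂, ← hY₁,
    ← hY₂, ← hX₁₁, ← hX₁₂, ← hX₂₂, ← hY₁₁, ← hY₁₂, ← hY₂₂] at key
  obtain ⟨k₀, k₁, k₂, k₃⟩ := cubic_coeff_eq_zero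
    (c₀ := (X₁ * Y₂ - X₂ * Y₁) * E.P z + X₁ * Y₁₁ - Y₁ * X₁₁
      - (E'.P (T z) * X₁ ^ 3 + 3 * E'.Q (T z) * X₁ ^ 2 * Y₁ + 3 * E'.R (T z) * X₁ * Y₁ ^ 2
        + E'.S (T z) * Y₁ ^ 3))
    (c₁ := 3 * (X₁ * Y₂ - X₂ * Y₁) * E.Q z + X₂ * Y₁₁ + 2 * X₁ * Y₁₂ - Y₂ * X₁₁ - 2 * Y₁ * X₁₂
      - (3 * E'.P (T z) * X₁ ^ 2 * X₂ + 3 * E'.Q (T z) * (2 * X₁ * X₂ * Y₁ + X₁ ^ 2 * Y₂)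
        + 3 * E'.R (T z) * (X₂ * Y₁ ^ 2 + 2 * X₁ * Y₁ * Y₂) + 3 * E'.S (T z) * Y₁ ^ 2 * Y₂))
    (c₂ := 3 * (X₁ * Y₂ - X₂ * Y₁) * E.R z + X₁ * Y₂₂ + 2 * X₂ * Y₁₂ - Y₁ * X₂₂ - 2 * Y₂ * X₁₂
      - (3 * E'.P (T z) * X₁ * X₂ ^ 2 + 3 * E'.Q (T z) * (2 * X₁ * X₂ * Y₂ + X₂ ^ 2 * Y₁)
        + 3 * E'.R (T z) * (X₁ * Y₂ ^ 2 + 2 * X₂ * Y₁ * Y₂) + 3 * E'.S (T z) * Y₁ * Y₂ ^ 2))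
    (c₃ := (X₁ * Y₂ - X₂ * Y₁) * E.S z + X₂ * Y₂₂ - Y₂ * X₂₂
      - (E'.P (T z) * X₂ ^ 3 + 3 * E'.Q (T z) * X₂ ^ 2 * Y₂ + 3 * E'.R (T z) * X₂ * Y₂ ^ 2
        + E'.S (T z) * Y₂ ^ 3)) hX (fun p hp => by
    have := key p hp
    field_simp at this
    linear_combination this)
  exact ⟨sub_eq_zero.1 k₀, sub_eq_zero.1 k₁, sub_eq_zero.1 k₂, sub_eq_zero.1 k₃⟩

end CubicODE.TransformsInto
end PointTransformation

/-! ### The fields of an equation as germs -/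

/-- The partial derivatives of germs. -/
def SmoothGerm.frame {𝕜 : Type*} [RCLike 𝕜] (z : 𝕜 × 𝕜) : Frame (SmoothGerm z) :=
  ⟨ddx z, ddy z, ddy_ddx⟩

namespace CubicODE

open SmoothGerm

variable {𝕜 : Type*} [RCLike 𝕜] {E : CubicODE 𝕜} {z : 𝕜 × 𝕜}

/-- The germs of the coefficients of an equation. -/
def germ (E : CubicODE 𝕜) (hz : z ∈ E.dom) : Coeffs (SmoothGerm z) where
  P := of E.P (E.smooth_P.contDiffAt (E.isOpen_dom.mem_nhds hz))
  Q := of E.Q (E.smooth_Q.contDiffAt (E.isOpen_dom.mem_nhds hz))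
  R := of E.R (E.smooth_R.contDiffAt (E.isOpen_dom.mem_nhds hz))
  S := of E.S (E.smooth_S.contDiffAt (E.isOpen_dom.mem_nhds hz))

section Rep

variable (hz : z ∈ E.dom)

theorem rep_P : Rep E.P (E.germ hz).P := rfl

theorem rep_Q : Rep E.Q (E.germ hz).Q := rfl

theorem rep_R : Rep E.R (E.germ hz).R := rfl

theorem rep_S : Rep E.S (E.germ hz).S := rfl

theorem rep_A : Rep E.A ((frame z).A (E.germ hz)) := by
  have hP := E.rep_P hz
  have hQ := E.rep_Q hz
  have hR := E.rep_R hz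
  have hS := E.rep_S hz
  exact (((((((hP.dy.dy.sub ((Rep.ofNat 2).mul hQ.dy.dx)).add hR.dx.dx).add
    (((Rep.ofNat 2).mul hP).mul hS.dx)).add (hS.mul hP.dx)).sub
    (((Rep.ofNat 3).mul hP).mul hR.dy)).sub (((Rep.ofNat 3).mul hR).mul hP.dy)).sub
    (((Rep.ofNat 3).mul hQ).mul hR.dx)).add (((Rep.ofNat 6).mul hQ).mul hQ.dy)

theorem rep_B : Rep E.B ((frame z).B (E.germ hz)) := by
  have hP := E.rep_P hz
  have hQ := E.rep_Q hz
  have hR := E.rep_R hz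
  have hS := E.rep_S hz
  exact (((((((hS.dx.dx.sub ((Rep.ofNat 2).mul hR.dy.dx)).add hQ.dy.dy).sub
    (((Rep.ofNat 2).mul hS).mul hP.dy)).sub (hP.mul hS.dy)).add
    (((Rep.ofNat 3).mul hS).mul hQ.dx)).add (((Rep.ofNat 3).mul hQ).mul hS.dx)).add
    (((Rep.ofNat 3).mul hR).mul hQ.dy)).sub (((Rep.ofNat 6).mul hR).mul hR.dx)

theorem rep_G : Rep E.G ((frame z).G (E.germ hz)) := by
  have hA := E.rep_A hz
  have hB := E.rep_B hz
  exact (((((hB.neg.mul hB.dx).sub (((Rep.ofNat 3).mul hA).mul hB.dy)).add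
    (((Rep.ofNat 4).mul hB).mul hA.dy)).add
    (((Rep.ofNat 3).mul (E.rep_S hz)).mul (hA.pow 2))).sub
    ((((Rep.ofNat 6).mul (E.rep_R hz)).mul hB).mul hA)).add
    (((Rep.ofNat 3).mul (E.rep_Q hz)).mul (hB.pow 2))

theorem rep_H : Rep E.H ((frame z).H (E.germ hz)) := by
  have hA := E.rep_A hz
  have hB := E.rep_B hz
  exact (((((hA.neg.mul hA.dy).sub (((Rep.ofNat 3).mul hB).mul hA.dx)).add
    (((Rep.ofNat 4).mul hA).mul hB.dx)).sub
    (((Rep.ofNat 3).mul (E.rep_P hz)).mul (hB.pow 2))).add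
    ((((Rep.ofNat 6).mul (E.rep_Q hz)).mul hA).mul hB)).sub
    (((Rep.ofNat 3).mul (E.rep_R hz)).mul (hA.pow 2))

end Rep

theorem patch_subset_dom (br : Branch) : E.patch br ⊆ E.dom := by
  cases br <;> exact fun _ h => h.1

theorem isOpen_patch (br : Branch) : IsOpen (E.patch br) := by
  refine isOpen_iff_mem_nhds.2 fun z hz => ?_
  have hd := patch_subset_dom br hz
  cases br
  · filter_upwards [E.isOpen_dom.mem_nhds hd,
      (E.rep_A hd).contDiffAt.continuousAt.eventually_ne hz.2] with w h1 h2 using ⟨h1, h2⟩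
  · filter_upwards [E.isOpen_dom.mem_nhds hd,
      (E.rep_B hd).contDiffAt.continuousAt.eventually_ne hz.2] with w h1 h2 using ⟨h1, h2⟩

theorem A_ne_zero_or_B_ne_zero {br : Branch} (hz : z ∈ E.patch br) : E.A z ≠ 0 ∨ E.B z ≠ 0 := by
  cases br
  exacts [Or.inl hz.2, Or.inr hz.2]

variable {hz : z ∈ E.dom} {br : Branch} {φ₁ φ₂ : SmoothGerm z}

theorem F5_eq_zero_of_isGauge (hφ : (frame z).IsGauge (E.germ hz) φ₁ φ₂) : E.F5 z = 0 := by
  have h := congrArg (eval z) hφ.A_mul_G_add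
  rw [map_add, map_mul, map_mul, map_zero, (E.rep_A hz).eval_eq, (E.rep_B hz).eval_eq,
    (E.rep_G hz).eval_eq, (E.rep_H hz).eval_eq] at h
  rw [F5, h, zero_div]

theorem eventually_isGauge (hφ : (frame z).IsGauge (E.germ hz) φ₁ φ₂) {f₁ f₂ : 𝕜 × 𝕜 → 𝕜}
    (h₁ : Rep f₁ φ₁) (h₂ : Rep f₂ φ₂) : ∀ᶠ w in 𝓝 z,
      5 * E.A w * f₁ w = -3 * (E.B w * E.P w + dx E.A w) + 3 * E.Q w * E.A w ∧
      5 * (E.A w * f₂ w + E.B w * f₁ w) = -3 * (dx E.B w + dy E.A w) - 6 * E.B w * E.Q w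
        + 6 * E.A w * E.R w ∧
      5 * E.B w * f₂ w = 3 * (E.A w * E.S w - dy E.B w) - 3 * E.R w * E.B w := by
  have hA := E.rep_A hz
  have hB := E.rep_B hz
  have hP := E.rep_P hz
  have hQ := E.rep_Q hz
  have hR := E.rep_R hz
  have hS := E.rep_S hz
  have e₁₁ := ((((Rep.ofNat 5).mul hA).mul h₁).eq_iff
    (((Rep.ofNat 3).neg.mul ((hB.mul hP).add hA.dx)).add (((Rep.ofNat 3).mul hQ).mul hA))).1 hφ.eq₁₁
  have e₁₂ := (((Rep.ofNat 5).mul ((hA.mul h₂).add (hB.mul h₁))).eq_iff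
    ((((Rep.ofNat 3).neg.mul (hB.dx.add hA.dy)).sub (((Rep.ofNat 6).mul hB).mul hQ)).add
      (((Rep.ofNat 6).mul hA).mul hR))).1 hφ.eq₁₂
  have e₂₂ := ((((Rep.ofNat 5).mul hB).mul h₂).eq_iff
    (((Rep.ofNat 3).mul ((hA.mul hS).sub hB.dy)).sub (((Rep.ofNat 3).mul hR).mul hB))).1 hφ.eq₂₂
  filter_upwards [e₁₁, e₁₂, e₂₂] with w h h' h'' using ⟨h, h', h''⟩

/-- The formulas solve the first two gauge equations where A ≠ 0 and the last two where B ≠ 0, so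
any gauge agrees with them. -/
theorem rep_phi₁ (hbr : z ∈ E.patch br) (hφ : (frame z).IsGauge (E.germ hz) φ₁ φ₂) :
    Rep (E.phi₁ br) φ₁ := by
  obtain ⟨f₁, -, h₁⟩ := exists_rep φ₁
  obtain ⟨f₂, -, h₂⟩ := exists_rep φ₂
  refine h₁.congr ?_
  filter_upwards [eventually_isGauge hφ h₁ h₂, (isOpen_patch br).mem_nhds hbr] with w h hw
  obtain ⟨h11, h12, h22⟩ := h
  cases br
  · have hA : E.A w ≠ 0 := hw.2
    simp only [phi₁]
    field_simp
    linear_combination -h11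
  · have hB : E.B w ≠ 0 := hw.2
    simp only [phi₁]
    field_simp
    linear_combination -E.B w * h12 + E.A w * h22

theorem rep_phi₂ (hbr : z ∈ E.patch br) (hφ : (frame z).IsGauge (E.germ hz) φ₁ φ₂) :
    Rep (E.phi₂ br) φ₂ := by
  obtain ⟨f₁, -, h₁⟩ := exists_rep φ₁
  obtain ⟨f₂, -, h₂⟩ := exists_rep φ₂
  refine h₂.congr ?_
  filter_upwards [eventually_isGauge hφ h₁ h₂, (isOpen_patch br).mem_nhds hbr] with w h hw
  obtain ⟨h11, h12, h22⟩ := h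
  cases br
  · have hA : E.A w ≠ 0 := hw.2
    simp only [phi₂]
    field_simp
    linear_combination -E.A w * h12 + E.B w * h11
  · have hB : E.B w ≠ 0 := hw.2
    simp only [phi₂]
    field_simp
    linear_combination -h22

theorem rep_N (hbr : z ∈ E.patch br) (hφ : (frame z).IsGauge (E.germ hz) φ₁ φ₂)
    {n : SmoothGerm z} (hn : 6 * n = -5 * (frame z).curl (E.germ hz) φ₁ φ₂) :
    Rep (E.N br) n := by
  have hA := E.rep_A hz
  have hB := E.rep_B hz
  have hG := E.rep_G hz
  have hH := E.rep_H hz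
  obtain ⟨f, -, hf⟩ := exists_rep n
  have eA : 6 * ((frame z).A (E.germ hz) * n) = -2 * (frame z).H (E.germ hz) := by
    linear_combination (frame z).A (E.germ hz) * hn - hφ.A_mul_curl
  have eB : 6 * ((frame z).B (E.germ hz) * n) = 2 * (frame z).G (E.germ hz) := by
    linear_combination (frame z).B (E.germ hz) * hn - hφ.B_mul_curl
  refine hf.congr ?_
  filter_upwards [(((Rep.ofNat 6).mul (hA.mul hf)).eq_iff ((Rep.ofNat 2).neg.mul hH)).1 eA,
    (((Rep.ofNat 6).mul (hB.mul hf)).eq_iff ((Rep.ofNat 2).mul hG)).1 eB,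
    (isOpen_patch br).mem_nhds hbr] with w h1 h2 hw
  cases br
  · have hA : E.A w ≠ 0 := hw.2
    simp only [N]
    field_simp
    linear_combination -h1 / 2
  · have hB : E.B w ≠ 0 := hw.2
    simp only [N]
    field_simp
    linear_combination -h2 / 2

theorem rep_Omega (hbr : z ∈ E.patch br) (hφ : (frame z).IsGauge (E.germ hz) φ₁ φ₂) :
    Rep (E.Omega br) (SmoothGerm.const z (5 / 3) * ((frame z).d₂ φ₁ - (frame z).d₁ φ₂)) :=
  (Rep.const (5 / 3)).mul ((rep_phi₁ hbr hφ).dy.sub (rep_phi₂ hbr hφ).dx)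

theorem rep_nabla₁ (hbr : z ∈ E.patch br) (hφ : (frame z).IsGauge (E.germ hz) φ₁ φ₂) (m : ℕ)
    {f : 𝕜 × 𝕜 → 𝕜} {g : SmoothGerm z} (hf : Rep f g) :
    Rep (E.nabla₁ br m f) ((frame z).cov₁ φ₁ m g) :=
  hf.dx.add (((Rep.natCast m).mul (rep_phi₁ hbr hφ)).mul hf)

theorem rep_nabla₂ (hbr : z ∈ E.patch br) (hφ : (frame z).IsGauge (E.germ hz) φ₁ φ₂) (m : ℕ)
    {f : 𝕜 × 𝕜 → 𝕜} {g : SmoothGerm z} (hf : Rep f g) :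
    Rep (E.nabla₂ br m f) ((frame z).cov₂ φ₂ m g) :=
  hf.dy.add (((Rep.natCast m).mul (rep_phi₂ hbr hφ)).mul hf)

theorem rep_M (hbr : z ∈ E.patch br) (hφ : (frame z).IsGauge (E.germ hz) φ₁ φ₂)
    {n : SmoothGerm z} (hn : 6 * n = -5 * (frame z).curl (E.germ hz) φ₁ φ₂) :
    Rep (E.M br) ((frame z).M (E.germ hz) φ₁ φ₂ n) := by
  have hN := rep_N hbr hφ hn
  have h : Rep (E.M br) _ := (((E.rep_A hz).mul (rep_nabla₂ hbr hφ 2 hN)).add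
    ((E.rep_B hz).mul (rep_nabla₁ hbr hφ 2 hN).neg)).neg
  convert h using 1
  rw [Frame.M]; ring

theorem rep_Z (hbr : z ∈ E.patch br) (hφ : (frame z).IsGauge (E.germ hz) φ₁ φ₂)
    {n : SmoothGerm z} (hn : 6 * n = -5 * (frame z).curl (E.germ hz) φ₁ φ₂) :
    Rep (E.Z br) ((frame z).Z φ₁ φ₂ n ((frame z).M (E.germ hz) φ₁ φ₂ n)) := by
  have hN := rep_N hbr hφ hn
  have hM := rep_M hbr hφ hn
  have h : Rep (E.Z br) _ :=
    ((rep_nabla₂ hbr hφ 4 hM).mul (rep_nabla₁ hbr hφ 2 hN).neg).sub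
      ((rep_nabla₁ hbr hφ 4 hM).neg.mul (rep_nabla₂ hbr hφ 2 hN))
  convert h using 1
  rw [Frame.Z]; ring

theorem rep_I1 (hbr : z ∈ E.patch br) (hφ : (frame z).IsGauge (E.germ hz) φ₁ φ₂)
    {n : SmoothGerm z} (hn : 6 * n = -5 * (frame z).curl (E.germ hz) φ₁ φ₂) (hu : IsUnit n)
    {i : SmoothGerm z} (hi : i * n ^ 2 = (frame z).M (E.germ hz) φ₁ φ₂ n) : Rep (E.I1 br) i :=
  (rep_M hbr hφ hn).div ((rep_N hbr hφ hn).pow 2) hi (hu.pow 2)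

theorem rep_alphaDeriv (hbr : z ∈ E.patch br) (hφ : (frame z).IsGauge (E.germ hz) φ₁ φ₂)
    {n : SmoothGerm z} (hn : 6 * n = -5 * (frame z).curl (E.germ hz) φ₁ φ₂) (hu : IsUnit n)
    {f : 𝕜 × 𝕜 → 𝕜} {g i : SmoothGerm z} (hf : Rep f g)
    (hi : i * n = (frame z).B (E.germ hz) * (frame z).d₁ g
      - (frame z).A (E.germ hz) * (frame z).d₂ g) : Rep (E.alphaDeriv br f) i :=
  (((E.rep_B hz).mul hf.dx).sub ((E.rep_A hz).mul hf.dy)).div (rep_N hbr hφ hn) hi hu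

end CubicODE

/-! ### Transport from PIV to an equivalent equation -/

namespace CubicODE

open SmoothGerm

variable {𝕜 : Type*} [RCLike 𝕜] {E E' : CubicODE 𝕜} {z : 𝕜 × 𝕜}
  {T : OpenPartialHomeomorph (𝕜 × 𝕜) (𝕜 × 𝕜)} {a b : 𝕜}

/-- The coefficients of the target equation as germs at a point of the source. -/
def TransformsInto.pullback (h : E.TransformsInto E' T) (hz : z ∈ T.source) :
    Coeffs (SmoothGerm z) :=
  have hn := E'.isOpen_dom.mem_nhds (h.2.1 (T.map_source hz))
  { P := of (fun w => E'.P (T w)) ((E'.smooth_P.contDiffAt hn).comp z (h.contDiffAt hz))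
    Q := of (fun w => E'.Q (T w)) ((E'.smooth_Q.contDiffAt hn).comp z (h.contDiffAt hz))
    R := of (fun w => E'.R (T w)) ((E'.smooth_R.contDiffAt hn).comp z (h.contDiffAt hz))
    S := of (fun w => E'.S (T w)) ((E'.smooth_S.contDiffAt hn).comp z (h.contDiffAt hz)) }

/-- The germ of the first component of a point transformation. -/
def TransformsInto.fstGerm (h : E.TransformsInto E' T) (hz : z ∈ T.source) : SmoothGerm z :=
  of (fun w => (T w).1) (h.contDiffAt hz).fst

/-- The germ of the second component of a point transformation. -/
def TransformsInto.sndGerm (h : E.TransformsInto E' T) (hz : z ∈ T.source) : SmoothGerm z :=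
  of (fun w => (T w).2) (h.contDiffAt hz).snd

theorem TransformsInto.coeffLaw (h : E.TransformsInto E' T) (hz : z ∈ T.source) :
    (frame z).CoeffLaw (h.fstGerm hz) (h.sndGerm hz) (E.germ (h.1 hz)) (h.pullback hz) := by
  have hX : Rep (fun w => (T w).1) (h.fstGerm hz) := rfl
  have hY : Rep (fun w => (T w).2) (h.sndGerm hz) := rfl
  have hP : Rep (fun w => E'.P (T w)) (h.pullback hz).P := rfl
  have hQ : Rep (fun w => E'.Q (T w)) (h.pullback hz).Q := rfl
  have hR : Rep (fun w => E'.R (T w)) (h.pullback hz).R := rfl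
  have hS : Rep (fun w => E'.S (T w)) (h.pullback hz).S := rfl
  have hJ := (hX.dx.mul hY.dy).sub (hX.dy.mul hY.dx)
  have h2 := Rep.ofNat (z := z) (𝕜 := 𝕜) 2
  have h3 := Rep.ofNat (z := z) (𝕜 := 𝕜) 3
  have key := fun w (hw : w ∈ T.source) => h.coeff_eq hw rfl rfl rfl rfl rfl rfl rfl rfl rfl rfl
  have hs := T.open_source.mem_nhds hz
  constructor
  · refine ((((hJ.mul (E.rep_P _)).add (hX.dx.mul hY.dx.dx)).sub (hY.dx.mul hX.dx.dx)).eq_iff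
      ((((hP.mul (hX.dx.pow 3)).add (((h3.mul hQ).mul (hX.dx.pow 2)).mul hY.dx)).add
        (((h3.mul hR).mul hX.dx).mul (hY.dx.pow 2))).add (hS.mul (hY.dx.pow 3)))).2 ?_
    filter_upwards [hs] with w hw using (key w hw).1
  · refine ((((((h3.mul hJ).mul (E.rep_Q _)).add (hX.dy.mul hY.dx.dx)).add
      ((h2.mul hX.dx).mul hY.dy.dx)).sub (hY.dy.mul hX.dx.dx)).sub
        ((h2.mul hY.dx).mul hX.dy.dx)).eq_iff
      ((((((h3.mul hP).mul (hX.dx.pow 2)).mul hX.dy).add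
        ((h3.mul hQ).mul ((((h2.mul hX.dx).mul hX.dy).mul hY.dx).add
          ((hX.dx.pow 2).mul hY.dy)))).add
        ((h3.mul hR).mul ((hX.dy.mul (hY.dx.pow 2)).add
          (((h2.mul hX.dx).mul hY.dx).mul hY.dy)))).add
        (((h3.mul hS).mul (hY.dx.pow 2)).mul hY.dy)) |>.2 ?_
    filter_upwards [hs] with w hw using (key w hw).2.1
  · refine ((((((h3.mul hJ).mul (E.rep_R _)).add (hX.dx.mul hY.dy.dy)).add
      ((h2.mul hX.dy).mul hY.dy.dx)).sub (hY.dx.mul hX.dy.dy)).sub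
        ((h2.mul hY.dy).mul hX.dy.dx)).eq_iff
      ((((((h3.mul hP).mul hX.dx).mul (hX.dy.pow 2)).add
        ((h3.mul hQ).mul ((((h2.mul hX.dx).mul hX.dy).mul hY.dy).add
          ((hX.dy.pow 2).mul hY.dx)))).add
        ((h3.mul hR).mul ((hX.dx.mul (hY.dy.pow 2)).add
          (((h2.mul hX.dy).mul hY.dx).mul hY.dy)))).add
        (((h3.mul hS).mul hY.dx).mul (hY.dy.pow 2))) |>.2 ?_
    filter_upwards [hs] with w hw using (key w hw).2.2.1
  · refine ((((hJ.mul (E.rep_S _)).add (hX.dy.mul hY.dy.dy)).sub (hY.dy.mul hX.dy.dy)).eq_iff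
      ((((hP.mul (hX.dy.pow 3)).add (((h3.mul hQ).mul (hX.dy.pow 2)).mul hY.dy)).add
        (((h3.mul hR).mul hX.dy).mul (hY.dy.pow 2))).add (hS.mul (hY.dy.pow 3)))).2 ?_
    filter_upwards [hs] with w hw using (key w hw).2.2.2

theorem TransformsInto.eval_jac (h : E.TransformsInto E' T) (hz : z ∈ T.source) :
    eval z ((frame z).jac (h.fstGerm hz) (h.sndGerm hz))
      = dx (fun w => (T w).1) z * dy (fun w => (T w).2) z
        - dy (fun w => (T w).1) z * dx (fun w => (T w).2) z :=
  have hX : Rep (fun w => (T w).1) (h.fstGerm hz) := rfl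
  have hY : Rep (fun w => (T w).2) (h.sndGerm hz) := rfl
  ((hX.dx.mul hY.dy).sub (hX.dy.mul hY.dx)).eval_eq

theorem isUnit_of_eval_ne_zero {g : SmoothGerm z} (hg : eval z g ≠ 0) : IsUnit g := by
  obtain ⟨f, -, hf⟩ := exists_rep g
  exact hf.isUnit (by rwa [← hf.eval_eq])

theorem painleveIV_snd_ne_zero (h : E.TransformsInto (painleveIV a b) T) (hz : z ∈ T.source) :
    (T z).2 ≠ 0 := h.2.1 (T.map_source hz)

/-- A coordinate frame on the source in which the equation becomes the fourth Painlevé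
equation. -/
theorem TransformsInto.exists_frame (h : E.TransformsInto (painleveIV a b) T)
    (hz : z ∈ T.source) : ∃ (F : Frame (SmoothGerm z)) (c : Coeffs (SmoothGerm z))
      (X Y W δ : SmoothGerm z), (frame z).CoordChange F X Y δ ∧
      (frame z).Covariant F X Y δ (E.germ (h.1 hz)) c ∧
      F.IsPainleveIV c X Y W (SmoothGerm.const z a) (SmoothGerm.const z b) ∧
      eval z ((frame z).jac X Y) ≠ 0 ∧
      eval z X = (T z).1 ∧ eval z W = ((T z).2)⁻¹ := by
  have hX : Rep (fun w => (T w).1) (h.fstGerm hz) := rfl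
  have hY : Rep (fun w => (T w).2) (h.sndGerm hz) := rfl
  have hj0 : eval z ((frame z).jac (h.fstGerm hz) (h.sndGerm hz)) ≠ 0 := by
    rw [h.eval_jac hz]; exact h.jac_ne_zero hz
  obtain ⟨δ, hδ⟩ := (isUnit_of_eval_ne_zero hj0).exists_left_inv
  rw [Frame.jac] at hδ
  have hW := rep_of (fun w => ((T w).2)⁻¹)
    ((h.contDiffAt hz).snd.inv (painleveIV_snd_ne_zero h hz))
  set W := of (fun w => ((T w).2)⁻¹)
    ((h.contDiffAt hz).snd.inv (painleveIV_snd_ne_zero h hz))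
  have hF := Frame.coordChange_coordFrame (D := frame z) hδ
  -- A germ with nonzero value is a unit, and X_x, X_y cannot both vanish at z because J does not.
  have hXu : IsUnit ((frame z).d₁ (h.fstGerm hz)) ∨ IsUnit ((frame z).d₂ (h.fstGerm hz)) := by
    by_contra! hc
    have h₁ : eval z ((frame z).d₁ (h.fstGerm hz)) = 0 := by
      by_contra h0; exact hc.1 (isUnit_of_eval_ne_zero h0)
    have h₂ : eval z ((frame z).d₂ (h.fstGerm hz)) = 0 := by
      by_contra h0; exact hc.2 (isUnit_of_eval_ne_zero h0)
    exact hj0 (by rw [Frame.jac, map_sub, map_mul, map_mul, h₁, h₂]; ring)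
  refine ⟨_, h.pullback hz, h.fstGerm hz, h.sndGerm hz, W, δ, hF,
    hF.covariant (h.coeffLaw hz) (isUnit_ofNat 3) hXu, ?_, hj0, hX.eval_eq, hW.eval_eq⟩
  have hc : ∀ d : 𝕜, (frame z).d₁ (SmoothGerm.const z d) = 0 := fun d => deriv_const _ d
  have hc' : ∀ d : 𝕜, (frame z).d₂ (SmoothGerm.const z d) = 0 := fun d => deriv_const _ d
  have hP : Rep (fun w => (painleveIV a b).P (T w)) (h.pullback hz).P := rfl
  have hR : Rep (fun w => (painleveIV a b).R (T w)) (h.pullback hz).R := rfl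
  have h2 := Rep.ofNat (z := z) (𝕜 := 𝕜) 2
  have h3 := Rep.ofNat (z := z) (𝕜 := 𝕜) 3
  constructor
  · exact Frame.coordFrame_d₁_left hδ
  · exact Frame.coordFrame_d₂_left hδ
  · exact Frame.coordFrame_d₁_right hδ
  · exact Frame.coordFrame_d₂_right hδ
  · rw [Frame.coordFrame_d₁, hc, hc']; ring
  · rw [Frame.coordFrame_d₂, hc, hc']; ring
  · rw [Frame.coordFrame_d₁, hc, hc']; ring
  · rw [Frame.coordFrame_d₂, hc, hc']; ring
  · refine ((hY.mul hW).eq_iff Rep.one).2 ?_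
    filter_upwards [T.open_source.mem_nhds hz] with w hw
    exact mul_inv_cancel₀ (painleveIV_snd_ne_zero h hw)
  · refine ((h2.mul hP).eq_iff (((((h3.mul (hY.pow 3)).add (((Rep.ofNat 8).mul hX).mul
      (hY.pow 2))).add (((Rep.ofNat 4).mul ((hX.pow 2).sub (Rep.const a))).mul hY))).add
        ((h2.mul (Rep.const b)).mul hW))).2 (Eventually.of_forall fun w => ?_)
    simp only [painleveIV]
    ring
  · rfl
  · refine (((Rep.ofNat 6).mul hR).eq_iff hW).2 (Eventually.of_forall fun w => ?_)
    simp only [painleveIV]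
    ring
  · rfl

end CubicODE

namespace Frame.IsPainleveIV

variable {𝒪 : Type*} [CommRing 𝒪] {𝕜 : Type*} [RCLike 𝕜] {E : Frame 𝒪} {c : Coeffs 𝒪}
  {X Y W a b φ₁ φ₂ : 𝒪}

theorem Kₙ_eq_zero (h : IsPainleveIV E c X Y W a b) (h6 : IsUnit (6 : 𝒪))
    (hφ : IsGauge E c φ₁ φ₂) {n : 𝒪} (hn : 6 * n = -5 * E.curl c φ₁ φ₂) {i₁ i₄ i₁₀ : 𝒪}
    (hi₁ : i₁ * n ^ 2 = E.M c φ₁ φ₂ n) (hi₄ : i₄ * n = -E.A c * E.d₂ i₁)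
    (hi₁₀ : i₁₀ * n = -E.A c * E.d₂ i₄) (ev : 𝒪 →+* 𝕜) (h0 : ev n ≠ 0) :
    Kₙ (5 * ev i₁ / 72) (ev i₄ / 2160) (ev i₁₀ / 12960) = 0 := by
  obtain ⟨t, ht⟩ : ∃ t, t = X * W := ⟨_, rfl⟩
  obtain ⟨s, hs⟩ : ∃ s, s = b * W ^ 4 := ⟨_, rfl⟩
  obtain ⟨σ, hσ⟩ : ∃ σ, σ = 15 + 4 * t - 10 * s := ⟨_, rfl⟩
  obtain ⟨μ, hμ⟩ : ∃ μ, μ = 36 * t ^ 2 + 45 * t - 630 * t * s + 225 - 1350 * s := ⟨_, rfl⟩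
  obtain ⟨g, hg⟩ : ∃ g, g = 15 + 12 * t + 6 * s := ⟨_, rfl⟩
  obtain ⟨σ₁, hσ₁⟩ : ∃ σ₁, σ₁ = 4 * t - 40 * s := ⟨_, rfl⟩
  obtain ⟨μ₁, hμ₁⟩ : ∃ μ₁, μ₁ = 72 * t ^ 2 + 45 * t - 3150 * t * s - 5400 * s := ⟨_, rfl⟩
  obtain ⟨g₁, hg₁⟩ : ∃ g₁, g₁ = 12 * t + 24 * s := ⟨_, rfl⟩
  obtain ⟨σ₂, hσ₂⟩ : ∃ σ₂, σ₂ = 4 * t - 160 * s := ⟨_, rfl⟩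
  obtain ⟨μ₂, hμ₂⟩ : ∃ μ₂, μ₂ = 144 * t ^ 2 + 45 * t - 15750 * t * s - 21600 * s := ⟨_, rfl⟩
  obtain ⟨U, hU⟩ : ∃ U, U = μ₁ * σ - 2 * σ₁ * μ := ⟨_, rfl⟩
  obtain ⟨V, hV⟩ : ∃ V, V = g * U := ⟨_, rfl⟩
  obtain ⟨U₁, hU₁⟩ : ∃ U₁, U₁ = μ₂ * σ - μ₁ * σ₁ - 2 * σ₂ * μ := ⟨_, rfl⟩
  obtain ⟨V₁, hV₁⟩ : ∃ V₁, V₁ = g₁ * U + g * U₁ := ⟨_, rfl⟩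
  obtain ⟨e, -, r₁, r₄, r₁₀⟩ := h.invariants_eq h6 hφ hn hi₁ hi₄ hi₁₀ ht hs hσ hμ hg hσ₁ hμ₁ hg₁
    hσ₂ hμ₂ hU hV hU₁ hV₁
  replace e := congrArg ev e
  replace r₁ := congrArg ev r₁
  replace r₄ := congrArg ev r₄
  replace r₁₀ := congrArg ev r₁₀
  simp only [map_sub, map_mul, map_pow, map_ofNat] at e r₁ r₄ r₁₀
  refine Kₙ_eq_zero_of_param (t := ev t) (s := ev s) (σ := ev σ) (μ := ev μ) (g := ev g)
    (σ₁ := ev σ₁) (μ₁ := ev μ₁) (g₁ := ev g₁) (σ₂ := ev σ₂) (μ₂ := ev μ₂) (U := ev U)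
    (V := ev V) (U₁ := ev U₁) (V₁ := ev V₁) ?_ ?_ ?_ ?_ ?_ ?_ ?_ ?_ ?_ ?_ ?_ ?_ ?_ ?_ ?_ ?_
  · simp only [hσ, map_add, map_sub, map_mul, map_ofNat]
  · simp only [hμ, map_add, map_sub, map_mul, map_pow, map_ofNat]
  · simp only [hg, map_add, map_mul, map_ofNat]
  · simp only [hσ₁, map_sub, map_mul, map_ofNat]
  · simp only [hμ₁, map_add, map_sub, map_mul, map_pow, map_ofNat]
  · simp only [hg₁, map_add, map_mul, map_ofNat]
  · simp only [hσ₂, map_sub, map_mul, map_ofNat]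
  · simp only [hμ₂, map_add, map_sub, map_mul, map_pow, map_ofNat]
  · simp only [hU, map_sub, map_mul, map_ofNat]
  · simp [hV]
  · simp only [hU₁, map_sub, map_mul, map_ofNat]
  · simp [hV₁]
  · rw [← e]; exact mul_ne_zero (by norm_num) h0
  · linear_combination r₁ / 8
  · linear_combination r₄ / 16
  · linear_combination r₁₀ / 32

theorem K₀_eq_zero (h : IsPainleveIV E c X Y W a 0) (h6 : IsUnit (6 : 𝒪))
    (hφ : IsGauge E c φ₁ φ₂) {n : 𝒪} (hn : 6 * n = -5 * E.curl c φ₁ φ₂) {i₁ i₄ i₁₀ : 𝒪}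
    (hi₁ : i₁ * n ^ 2 = E.M c φ₁ φ₂ n) (hi₄ : i₄ * n = -E.A c * E.d₂ i₁)
    (hi₁₀ : i₁₀ * n = -E.A c * E.d₂ i₄) (ev : 𝒪 →+* 𝕜) (h0 : ev n ≠ 0) :
    K₀ (5 * ev i₁ / 72) (ev i₄ / 2160) = 0 := by
  obtain ⟨e, -, r₁, r₄, -⟩ := h.invariants_eq h6 hφ hn hi₁ hi₄ hi₁₀ rfl rfl rfl rfl rfl rfl rfl
    rfl rfl rfl rfl rfl rfl rfl
  replace e := congrArg ev e
  replace r₁ := congrArg ev r₁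
  replace r₄ := congrArg ev r₄
  simp only [map_add, map_sub, map_mul, map_pow, map_ofNat, zero_mul, mul_zero,
    sub_zero, add_zero] at e r₁ r₄
  refine K₀_eq_zero_of_param (t := ev X * ev W) rfl rfl rfl rfl rfl ?_ ?_ ?_
  · rw [← e]; exact mul_ne_zero (by norm_num) h0
  · linear_combination r₁ / 8
  · linear_combination r₄ / 16

end Frame.IsPainleveIV

namespace CubicODE

open SmoothGerm

variable {𝕜 : Type*} [RCLike 𝕜] {E : CubicODE 𝕜} {z : 𝕜 × 𝕜}
  {T : OpenPartialHomeomorph (𝕜 × 𝕜) (𝕜 × 𝕜)} {a b : 𝕜}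

/-- The field α of `E` is J times the transposed Jacobian matrix applied to (A', 0), where A'
belongs to PIV; so it vanishes exactly with A', and the right-hand side is 2A'/y. -/
theorem A_ne_zero_or_B_ne_zero_iff (h : E.TransformsInto (painleveIV a b) T)
    (hz : z ∈ T.source) : (E.A z ≠ 0 ∨ E.B z ≠ 0) ↔
      15 + 12 * ((T z).1 * (T z).2⁻¹) + 6 * (b * (T z).2⁻¹ ^ 4) ≠ 0 := by
  obtain ⟨F, c, X, Y, W, δ, -, hcov, hP, hj, hX, hW⟩ := h.exists_frame hz
  have h6 : IsUnit (6 : SmoothGerm z) := isUnit_ofNat 6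
  have hg := congrArg (eval z) (hP.A_mul_W h6)
  have eb : eval z (SmoothGerm.const z b) = b := rfl
  simp only [map_add, map_mul, map_pow, map_ofNat, hX, hW, eb] at hg
  have hA := congrArg (eval z) hcov.A_eq
  have hB := congrArg (eval z) hcov.B_eq
  rw [(E.rep_A (h.1 hz)).eval_eq, hP.B_eq h6, mul_zero, add_zero, map_mul, map_mul] at hA
  rw [(E.rep_B (h.1 hz)).eval_eq, hP.B_eq h6, mul_zero, add_zero, map_mul, map_mul] at hB
  have hy := inv_ne_zero (painleveIV_snd_ne_zero h hz)
  rw [← hg, hA, hB]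
  constructor
  · rintro (h1 | h1) <;>
      exact mul_ne_zero (mul_ne_zero two_ne_zero (right_ne_zero_of_mul (right_ne_zero_of_mul h1))) hy
  · intro h1
    have h2 := right_ne_zero_of_mul (left_ne_zero_of_mul h1)
    by_contra! h3
    have h4 := (mul_eq_zero.1 ((mul_eq_zero.1 h3.1).resolve_left hj)).resolve_right h2
    have h5 := (mul_eq_zero.1 ((mul_eq_zero.1 h3.2).resolve_left hj)).resolve_right h2
    exact hj (by rw [Frame.jac, map_sub, map_mul, map_mul, h4, h5]; ring)

/-- Where α ≠ 0, PIV has a gauge, and covariance carries it to `E`; the curl, of weight 2, carries n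
to J²n. -/
theorem exists_gauge (h : E.TransformsInto (painleveIV a b) T) (hz : z ∈ T.source)
    (hAB : E.A z ≠ 0 ∨ E.B z ≠ 0) :
    ∃ (F : Frame (SmoothGerm z)) (c : Coeffs (SmoothGerm z))
      (X Y W δ φ₁ φ₂ φ₁' φ₂' n : SmoothGerm z), (frame z).CoordChange F X Y δ ∧
      (frame z).Covariant F X Y δ (E.germ (h.1 hz)) c ∧
      F.IsPainleveIV c X Y W (SmoothGerm.const z a) (SmoothGerm.const z b) ∧
      eval z ((frame z).jac X Y) ≠ 0 ∧
      eval z X = (T z).1 ∧ eval z W = ((T z).2)⁻¹ ∧ eval z (F.A c) ≠ 0 ∧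
      F.IsGauge c φ₁' φ₂' ∧ (frame z).IsGauge (E.germ (h.1 hz)) φ₁ φ₂ ∧
      (frame z).GaugeLaw X Y δ φ₁ φ₂ φ₁' φ₂' ∧
      6 * n = -5 * F.curl c φ₁' φ₂' ∧
      6 * ((frame z).jac X Y ^ 2 * n) = -5 * (frame z).curl (E.germ (h.1 hz)) φ₁ φ₂ := by
  obtain ⟨F, c, X, Y, W, δ, hF, hcov, hP, hj, hX, hW⟩ := h.exists_frame hz
  have h6 : IsUnit (6 : SmoothGerm z) := isUnit_ofNat 6
  have hA : eval z (F.A c) ≠ 0 := by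
    have hg := congrArg (eval z) (hP.A_mul_W h6)
    have eb : eval z (SmoothGerm.const z b) = b := rfl
    simp only [map_add, map_mul, map_pow, map_ofNat, hX, hW, eb] at hg
    have := (A_ne_zero_or_B_ne_zero_iff h hz).1 hAB
    rw [← hg] at this
    exact right_ne_zero_of_mul (left_ne_zero_of_mul this)
  obtain ⟨φ₁', φ₂', hφ'⟩ := hP.exists_isGauge h6 (isUnit_ofNat 5) (isUnit_of_eval_ne_zero hA)
  obtain ⟨k, hk⟩ := h6.exists_right_inv
  have hφ := hcov.isGauge φ₁' φ₂' hφ'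
  have hl : (frame z).GaugeLaw X Y δ _ _ φ₁' φ₂' := ⟨rfl, rfl⟩
  refine ⟨F, c, X, Y, W, δ, _, _, φ₁', φ₂', k * (-5 * F.curl c φ₁' φ₂'), hF, hcov, hP, hj, hX, hW,
    hA, hφ', hφ, hl, ?_, ?_⟩
  · linear_combination (-5 * F.curl c φ₁' φ₂') * hk
  · rw [hF.curl_eq hcov hl]
    linear_combination (frame z).jac X Y ^ 2 * (-5 * F.curl c φ₁' φ₂') * hk

theorem F5_eq_zero (h : E.TransformsInto (painleveIV a b) T) (hz : z ∈ T.source) :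
    E.F5 z = 0 := by
  by_cases hAB : E.A z ≠ 0 ∨ E.B z ≠ 0
  · obtain ⟨F, c, X, Y, W, δ, φ₁, φ₂, φ₁', φ₂', n, -, -, -, -, -, -, -, -, hφ, -⟩ :=
      exists_gauge h hz hAB
    exact F5_eq_zero_of_isGauge hφ
  · push Not at hAB
    rw [F5, hAB.1, hAB.2]; ring

variable {br : Branch}

theorem Omega_eq_zero (h : E.TransformsInto (painleveIV a b) T) (hz : z ∈ T.source)
    (hbr : z ∈ E.patch br) : E.Omega br z = 0 := by
  obtain ⟨F, c, X, Y, W, δ, φ₁, φ₂, φ₁', φ₂', n, hF, hcov, hP, hj, hX, hW, hA, hφ', hφ, hl, -⟩ :=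
    exists_gauge h hz (A_ne_zero_or_B_ne_zero hbr)
  rw [← (rep_Omega hbr hφ).eval_eq, hF.omega_eq hl, hP.omega_eq (isUnit_ofNat 6) (isUnit_ofNat 5)
    (isUnit_of_eval_ne_zero hA) hφ', mul_zero, mul_zero, map_zero]

theorem M_ne_zero (h : E.TransformsInto (painleveIV a b) T) (hz : z ∈ T.source)
    (hbr : z ∈ E.patch br) {t s : 𝕜} (ht : (T z).1 * (T z).2⁻¹ = t)
    (hs : b * (T z).2⁻¹ ^ 4 = s)
    (hne : 36 * t ^ 2 + 45 * t - 630 * t * s + 225 - 1350 * s ≠ 0) : E.M br z ≠ 0 := by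
  obtain ⟨F, c, X, Y, W, δ, φ₁, φ₂, φ₁', φ₂', n, hF, hcov, hP, hj, hX, hW, hA, hφ', hφ, hl, hn',
    hn⟩ := exists_gauge h hz (A_ne_zero_or_B_ne_zero hbr)
  have hM := congrArg (eval z) (hP.M_eq (isUnit_ofNat 6) hφ' hn')
  have eb : eval z (SmoothGerm.const z b) = b := rfl
  simp only [map_add, map_sub, map_mul, map_pow, map_ofNat, hX, hW, eb, ht, hs] at hM
  rw [← hM] at hne
  rw [← (rep_M hbr hφ hn).eval_eq, hF.M_eq hcov hl, map_mul, map_pow]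
  exact mul_ne_zero (pow_ne_zero 4 hj) (right_ne_zero_of_mul hne)

theorem Z_ne_zero (h : E.TransformsInto (painleveIV a b) T) (hz : z ∈ T.source)
    (hbr : z ∈ E.patch br) {t s : 𝕜} (ht : (T z).1 * (T z).2⁻¹ = t)
    (hs : b * (T z).2⁻¹ ^ 4 = s)
    (hne : -129600 * t ^ 3 - 162000 * t ^ 2 + 6674400 * t ^ 2 * s + 202500 * t
      + 17010000 * t * s + 6771600 * t * s ^ 2 + 253125 + 10833750 * s + 8545500 * s ^ 2
      + 1701000 * s ^ 3 ≠ 0) : E.Z br z ≠ 0 := by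
  obtain ⟨F, c, X, Y, W, δ, φ₁, φ₂, φ₁', φ₂', n, hF, hcov, hP, hj, hX, hW, hA, hφ', hφ, hl, hn',
    hn⟩ := exists_gauge h hz (A_ne_zero_or_B_ne_zero hbr)
  have hZ := congrArg (eval z) (hP.Z_eq (isUnit_ofNat 6) (isUnit_ofNat 5) hφ' hn')
  have eb : eval z (SmoothGerm.const z b) = b := rfl
  simp only [map_add, map_sub, map_neg, map_mul, map_pow, map_ofNat, hX, hW, eb, ht, hs] at hZ
  rw [← hZ] at hne
  rw [← (rep_Z hbr hφ hn).eval_eq, hF.M_eq hcov hl, hF.Z_eq hl, map_mul, map_pow]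
  exact mul_ne_zero (pow_ne_zero 7 hj) (right_ne_zero_of_mul hne)

/-- Since N ≠ 0, n is a unit and the invariants exist as germs. Having weight 0, the germs built for
PIV also represent those of `E`. -/
theorem K_eq_zero (h : E.TransformsInto (painleveIV a b) T) (hz : z ∈ T.source)
    (hbr : z ∈ E.patch br) (hN : E.N br z ≠ 0) :
    (b = 0 → K₀ (E.J1 br z) (E.J4 br z) = 0) ∧
      Kₙ (E.J1 br z) (E.J4 br z) (E.J10 br z) = 0 := by
  obtain ⟨F, c, X, Y, W, δ, φ₁, φ₂, φ₁', φ₂', n, hF, hcov, hP, hj, hX, hW, hA, hφ', hφ, hl, hn',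
    hn⟩ := exists_gauge h hz (A_ne_zero_or_B_ne_zero hbr)
  have h6 : IsUnit (6 : SmoothGerm z) := isUnit_ofNat 6
  rw [← (rep_N hbr hφ hn).eval_eq] at hN
  have hu := isUnit_of_eval_ne_zero hN
  rw [map_mul] at hN
  have hn0 := right_ne_zero_of_mul hN
  obtain ⟨ν, hν⟩ := (isUnit_of_eval_ne_zero hn0).exists_right_inv
  obtain ⟨i₁, hi₁⟩ : ∃ i, i * n ^ 2 = F.M c φ₁' φ₂' n :=
    ⟨F.M c φ₁' φ₂' n * ν ^ 2, by linear_combination F.M c φ₁' φ₂' n * (n * ν + 1) * hν⟩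
  obtain ⟨i₄, hi₄⟩ : ∃ i, i * n = -F.A c * F.d₂ i₁ :=
    ⟨-F.A c * F.d₂ i₁ * ν, by linear_combination (-F.A c * F.d₂ i₁) * hν⟩
  obtain ⟨i₁₀, hi₁₀⟩ : ∃ i, i * n = -F.A c * F.d₂ i₄ :=
    ⟨-F.A c * F.d₂ i₄ * ν, by linear_combination (-F.A c * F.d₂ i₄) * hν⟩
  have r₁ : Rep (E.I1 br) i₁ := rep_I1 hbr hφ hn hu (by
    rw [hF.M_eq hcov hl]; linear_combination (frame z).jac X Y ^ 4 * hi₁)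
  have r₄ : Rep (E.I4 br) i₄ := rep_alphaDeriv hbr hφ hn hu r₁ (by
    rw [hF.along_eq hcov, hP.B_eq h6]; linear_combination (frame z).jac X Y ^ 2 * hi₄)
  have r₁₀ : Rep (E.I10 br) i₁₀ := rep_alphaDeriv hbr hφ hn hu r₄ (by
    rw [hF.along_eq hcov, hP.B_eq h6]; linear_combination (frame z).jac X Y ^ 2 * hi₁₀)
  rw [J1, J4, J10, ← r₁.eval_eq, ← r₄.eval_eq, ← r₁₀.eval_eq]
  refine ⟨fun hb => ?_, hP.Kₙ_eq_zero h6 hφ' hn' hi₁ hi₄ hi₁₀ (eval z) hn0⟩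
  subst hb
  exact Frame.IsPainleveIV.K₀_eq_zero (hP : F.IsPainleveIV c X Y W _ 0) h6 hφ' hn' hi₁ hi₄ hi₁₀
    (eval z) hn0

/-- A nonzero polynomial in `x / y` does not vanish identically near any point of the source. -/
theorem exists_mem_eval_ne_zero (h : E.TransformsInto (painleveIV a b) T) (hz : z ∈ T.source)
    {O : Set (𝕜 × 𝕜)} (hO : O ∈ 𝓝 z) (p : 𝕜 → Polynomial 𝕜) (hp : ∀ s, p s ≠ 0) :
    ∃ w ∈ O ∩ T.source, (p (b * (T w).2⁻¹ ^ 4)).eval ((T w).1 * (T w).2⁻¹) ≠ 0 := by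
  have hO' : T '' (O ∩ T.source) ∈ 𝓝 (T z) :=
    T.image_mem_nhds hz (inter_mem hO (T.open_source.mem_nhds hz))
  set y := (T z).2 with hy
  have hy0 : y ≠ 0 := painleveIV_snd_ne_zero h hz
  -- Along y = const in the target, s = b/y⁴ is constant, so a single polynomial is involved; its
  -- finitely many roots cannot fill a neighbourhood.
  have hline : {x : 𝕜 | (x, y) ∈ T '' (O ∩ T.source)} ∈ 𝓝 (T z).1 :=
    (Continuous.prodMk_left y).continuousAt.preimage_mem_nhds hO'
  have hinf := infinite_of_mem_nhds _ hline
  have hfin : {x : 𝕜 | (p (b * y⁻¹ ^ 4)).eval (x * y⁻¹) = 0}.Finite := by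
    refine ((p (b * y⁻¹ ^ 4)).roots.toFinset.finite_toSet.preimage
      (mul_left_injective₀ (inv_ne_zero hy0)).injOn).subset fun x hx => ?_
    simpa [hp] using hx
  obtain ⟨x, ⟨w, hw, hwx⟩, hx⟩ := (hinf.sdiff hfin).nonempty
  refine ⟨w, hw, ?_⟩
  rw [hwx]
  exact hx

end CubicODE

end

theorem theorem5 {𝕜 : Type*} [RCLike 𝕜] (E : CubicODE 𝕜) (a b : 𝕜)
    (hE : E.PointEquivalent (painleveIV a b)) :
    (∀ z ∈ E.dom, E.F5 z = 0) ∧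
    (E.dom ⊆ closure {z | z ∈ E.dom ∧ (E.A z ≠ 0 ∨ E.B z ≠ 0)}) ∧
    ∀ br : Branch,
      (∀ z ∈ E.patch br, E.Omega br z = 0) ∧
      NotIdenticallyZeroOn (E.M br) (E.patch br) ∧
      NotIdenticallyZeroOn (E.Z br) (E.patch br) ∧
      (b = 0 → ∀ z ∈ E.patch br, E.N br z ≠ 0 → K₀ (E.J1 br z) (E.J4 br z) = 0) ∧
      (b ≠ 0 → ∀ z ∈ E.patch br, E.N br z ≠ 0 →
        Kₙ (E.J1 br z) (E.J4 br z) (E.J10 br z) = 0) := by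
  open CubicODE Polynomial in
  refine ⟨fun z hz => ?_, fun z hz => ?_, fun br => ⟨fun z hz => ?_, fun z hz => ?_, fun z hz => ?_,
    fun hb z hz hN => ?_, fun _ z hz hN => ?_⟩⟩
  · obtain ⟨T, hzT, hT⟩ := hE z hz
    exact F5_eq_zero hT hzT
  · obtain ⟨T, hzT, hT⟩ := hE z hz
    refine mem_closure_iff_nhds.2 fun O hO => ?_
    -- The polynomial is g in the variable t; its leading coefficient 12 is independent of s. For M
    -- and Z below, the leading coefficients 36 and −129600 play this role.
    obtain ⟨w, hw, hne⟩ := exists_mem_eval_ne_zero hT hzT hO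
      (fun s => C (15 + 6 * s) + C 12 * X) (fun s h0 => by
        simpa using congrArg (fun p => p.coeff 1) h0)
    refine ⟨w, hw.1, hT.1 hw.2, (A_ne_zero_or_B_ne_zero_iff hT hw.2).2 ?_⟩
    convert hne using 1
    simp only [eval_add, eval_mul, eval_C, eval_X]; ring
  · obtain ⟨T, hzT, hT⟩ := hE z (patch_subset_dom br hz)
    exact Omega_eq_zero hT hzT hz
  · obtain ⟨T, hzT, hT⟩ := hE z (patch_subset_dom br hz)
    refine mem_closure_iff_nhds.2 fun O hO => ?_
    obtain ⟨w, hw, hne⟩ := exists_mem_eval_ne_zero hT hzT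
      (Filter.inter_mem hO ((isOpen_patch br).mem_nhds hz))
      (fun s => C 36 * X ^ 2 + C (45 - 630 * s) * X + C (225 - 1350 * s)) (fun s h0 => by
        simpa [coeff_X, coeff_C] using congrArg (fun p => p.coeff 2) h0)
    refine ⟨w, hw.1.1, hw.1.2, M_ne_zero hT hw.2 hw.1.2 rfl rfl ?_⟩
    convert hne using 1
    simp only [eval_add, eval_mul, eval_pow, eval_C, eval_X]; ring
  · obtain ⟨T, hzT, hT⟩ := hE z (patch_subset_dom br hz)
    refine mem_closure_iff_nhds.2 fun O hO => ?_
    obtain ⟨w, hw, hne⟩ := exists_mem_eval_ne_zero hT hzT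
      (Filter.inter_mem hO ((isOpen_patch br).mem_nhds hz))
      (fun s => C (-129600) * X ^ 3 + C (6674400 * s - 162000) * X ^ 2
        + C (202500 + 17010000 * s + 6771600 * s ^ 2) * X
        + C (253125 + 10833750 * s + 8545500 * s ^ 2 + 1701000 * s ^ 3)) (fun s h0 => by
        simpa [-map_neg, -map_add, -map_sub, -map_mul, coeff_X, coeff_C, coeff_X_pow] using
          congrArg (fun p => p.coeff 3) h0)
    refine ⟨w, hw.1.1, hw.1.2, Z_ne_zero hT hw.2 hw.1.2 rfl rfl ?_⟩
    convert hne using 1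
    simp only [eval_add, eval_mul, eval_pow, eval_C, eval_X]; ring
  · obtain ⟨T, hzT, hT⟩ := hE z (patch_subset_dom br hz)
    exact (K_eq_zero hT hzT hz hN).1 hb
  · obtain ⟨T, hzT, hT⟩ := hE z (patch_subset_dom br hz)
    exact (K_eq_zero hT hzT hz hN).2
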